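/- Let $M$ be a smooth ($C^\infty$, Hausdorff) manifold of dimension $m$. On $TM\oplus T^*M$ consider the neutral metric $g((X,\alpha),(Y,\beta))=\frac12(\alpha(Y)+\beta(X))$, the $2$-form $\omega((X,\alpha),(Y,\beta))=\frac12(\alpha(Y)-\beta(X))$ and the Courant bracket $$[(X,\alpha),(Y,\beta)]=\big([X,Y],\,L_X\beta-L_Y\alpha+\tfrac12 d(\alpha(Y)-\beta(X))\big).$$ A big-isotropic structure on $M$ is a smooth $g$-isotropic subbundle $E\subseteq TM\oplus T^*M$ of some rank $k$. It is integrable if the space of its smooth sections is closed under the Courant bracket, and almost Dirac if it is maximal isotropic, i.e. $k=m$. Let $E'=E^{\perp_g}\supseteq E$, $\mathcal E=pr_{TM}E$, $\mathcal E'=pr_{TM}E'$; $E$ is regular if $\dim\mathcal E_x$ is constant. Let $\varpi_x:\mathcal E_x\times\mathcal E'_x\to\mathbb R$ be the well-defined bilinear map $$\varpi_x(X,Y)=\omega((X,\alpha),(Y,\beta))=\alpha(Y)=-\beta(X),\qquad (X,\alpha)\in E_x,\ (Y,\beta)\in E'_x,$$ which is skew-symmetric on $\mathcal E_x\times\mathcal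 E_x$, and put $\varpi_x(Y,X)=-\varpi_x(X,Y)$. A vector field of $\mathcal E$ (of $\mathcal E'$) is a smooth vector field on $M$ whose value at every $x$ lies in $\mathcal E_x$ (in $\mathcal E'_x$). For vector fields $X_1,X_2$ of $\mathcal E$ and $Y$ of $\mathcal E'$ put $$d_{tr}\varpi(X_1,X_2,Y)=X_1\varpi(X_2,Y)-X_2\varpi(X_1,Y)+Y\varpi(X_1,X_2)-\varpi([X_1,X_2],Y)+\varpi([X_1,Y],X_2)-\varpi([X_2,Y],X_1)$$ at each point where this makes sense, that is, where the three functions are differentiable along the integral curves of $X_1$, $X_2$, $Y$ respectively (their derivatives being taken along these curves) and where $[X_1,X_2]$ lies in $\mathcal E$ and $[X_1,Y],[X_2,Y]$ lie in $\mathcal E'$. Then: 1. If $E$ is integrable, then $d_{tr}\varpi(X_1,X_2,X_3)$ is defined at every point of $M$ and $d_{tr}\varpi(X_1,X_2,X_3)=0$ for all vector fields $X_1,X_2,X_3$ of $\mathcal E$. 2. If $E$ is almost Dirac or regular, then $E$ is integrable if and only if the following three conditions hold: (a) $\mathcal E$ is involutive, i.e. $[X_1,X_2]$ is a vector field of $\mathcal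 E$ for all vector fields $X_1,X_2$ of $\mathcal E$; (b) $[X,Y]$ is a vector field of $\mathcal E'$ for all vector fields $X$ of $\mathcal E$ and $Y$ of $\mathcal E'$; (c) $d_{tr}\varpi(X_1,X_2,Y)$ is defined at every point and equals $0$ for all vector fields $X_1,X_2$ of $\mathcal E$ and $Y$ of $\mathcal E'$. Moreover, for the "if" part it is enough that in (c) $d_{tr}\varpi(X_1,X_2,Y)$ vanishes at the points where it is defined. -/

import Mathlib

open scoped Manifold ContDiff Topology

noncomputable section

namespace BigIso

/-- The model space `ℝ^m`. -/
abbrev Model (m : ℕ) : Type := EuclideanSpace ℝ (Fin m)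

section Manifold

variable (m : ℕ) (M : Type*) [TopologicalSpace M] [ChartedSpace (Model m) M]

/-- Cotangent vectors at `x`. -/
abbrev Cotangent (x : M) : Type := TangentSpace (𝓡 m) x →L[ℝ] ℝ

/-- The fibre `T_x M ⊕ T_x^* M` of the big tangent bundle. -/
abbrev BigTangent (x : M) : Type := TangentSpace (𝓡 m) x × Cotangent m M x

/-- (Not necessarily continuous) vector fields on `M`. -/
abbrev VField : Type _ := (x : M) → TangentSpace (𝓡 m) x

/-- (Not necessarily continuous) `1`-forms on `M`. -/
abbrev OneForm : Type _ := (x : M) → Cotangent m M x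

/-- (Not necessarily continuous) sections `x ↦ (X x, α x)` of the big tangent bundle. -/
abbrev BigField : Type _ := (x : M) → BigTangent m M x

variable {m M}

/-- `X` is a smooth vector field on the set `U`. -/
def SmoothVFieldOn [IsManifold (𝓡 m) ∞ M] (X : VField m M) (U : Set M) : Prop :=
  ContMDiffOn (𝓡 m) ((𝓡 m).prod 𝓘(ℝ, Model m)) ∞
    (fun x => Bundle.TotalSpace.mk' (Model m) (E := fun x : M => TangentSpace (𝓡 m) x) x (X x)) U

/-- `α` is a smooth `1`-form on the set `U`: a smooth section of the bundle of continuous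
linear maps from the tangent bundle to the trivial line bundle. -/
def SmoothOneFormOn [IsManifold (𝓡 m) ∞ M] (α : OneForm m M) (U : Set M) : Prop :=
  ContMDiffOn (𝓡 m) ((𝓡 m).prod 𝓘(ℝ, Model m →L[ℝ] ℝ)) ∞
    (fun x => Bundle.TotalSpace.mk' (Model m →L[ℝ] ℝ)
      (E := fun x : M => TangentSpace (𝓡 m) x →L[ℝ] Bundle.Trivial M ℝ x) x (α x)) U

/-- `s = (X, α)` is a smooth section of the big tangent bundle over the set `U`. -/
def SmoothBigFieldOn [IsManifold (𝓡 m) ∞ M] (s : BigField m M) (U : Set M) : Prop :=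
  SmoothVFieldOn (fun x => (s x).1) U ∧ SmoothOneFormOn (fun x => (s x).2) U

/-- The neutral metric `g((X,α),(Y,β)) = (α(Y) + β(X)) / 2`. -/
def neutralMetric (x : M) : LinearMap.BilinForm ℝ (BigTangent m M x) :=
  LinearMap.mk₂ ℝ (fun u v => (u.2 v.1 + v.2 u.1) / 2)
    (by intro u u' v; simp; ring) (by intro c u v; simp; ring)
    (by intro u v v'; simp; ring) (by intro c u v; simp; ring)

/-- The skew form `ω((X,α),(Y,β)) = (α(Y) - β(X)) / 2`. -/
def bigOmega (x : M) : LinearMap.BilinForm ℝ (BigTangent m M x) :=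
  LinearMap.mk₂ ℝ (fun u v => (u.2 v.1 - v.2 u.1) / 2)
    (by intro u u' v; simp; ring) (by intro c u v; simp; ring)
    (by intro u v v'; simp; ring) (by intro c u v; simp; ring)

/-- The differential of a real function. -/
def dFun (f : M → ℝ) : OneForm m M := fun x => mfderiv (𝓡 m) 𝓘(ℝ, ℝ) f x

/-- The representative, on the model space, of the `1`-form `β` in the preferred chart at `x`. -/
def chartForm (β : OneForm m M) (x : M) (p : Model m) : Model m →L[ℝ] ℝ :=
  (β ((extChartAt (𝓡 m) x).symm p)).comp
    (mfderiv 𝓘(ℝ, Model m) (𝓡 m) (extChartAt (𝓡 m) x).symm p)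

/-- The representative, on the model space, of the vector field `X` in the preferred chart
at `x`. -/
def chartField (X : VField m M) (x : M) : Model m → Model m :=
  VectorField.mpullback 𝓘(ℝ, Model m) (𝓡 m) (extChartAt (𝓡 m) x).symm X

/-- The Lie derivative `L_X β` of a `1`-form. At `x` it is computed in the preferred chart at `x`
by the coordinate formula `(L_X β)_i = X^j ∂_j β_i + β_j ∂_i X^j`. -/
def lieDerivForm (X : VField m M) (β : OneForm m M) : OneForm m M := fun x =>
  (fderiv ℝ (chartForm β x) (extChartAt (𝓡 m) x x) (chartField X x (extChartAt (𝓡 m) x x))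
    + (chartForm β x (extChartAt (𝓡 m) x x)).comp
        (fderiv ℝ (chartField X x) (extChartAt (𝓡 m) x x))).comp
    (mfderiv (𝓡 m) 𝓘(ℝ, Model m) (extChartAt (𝓡 m) x) x)

/-- The Courant bracket
`[(X,α),(Y,β)] = ([X,Y], L_X β - L_Y α + d(α(Y) - β(X)) / 2)`. -/
def courantBracket (s t : BigField m M) : BigField m M := fun x =>
  (VectorField.mlieBracket (𝓡 m) (fun y => (s y).1) (fun y => (t y).1) x,
    lieDerivForm (fun y => (s y).1) (fun y => (t y).2) x
      - lieDerivForm (fun y => (t y).1) (fun y => (s y).2) x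
      + (1 / 2 : ℝ) • dFun (fun y => (s y).2 (t y).1 - (t y).2 (s y).1) x)

/-- `X` is a smooth vector field on `M` which belongs to the generalized distribution `D`. -/
def IsSmoothFieldIn [IsManifold (𝓡 m) ∞ M] (X : VField m M)
    (D : (x : M) → Submodule ℝ (TangentSpace (𝓡 m) x)) : Prop :=
  SmoothVFieldOn X Set.univ ∧ ∀ x, X x ∈ D x

/-- The derivative of the function `f` along the vector field `X` exists at `x` and equals `c`,
i.e. `f` is differentiable along the integral curve of `X` through `x`, with derivative `c`
at `x`. For `f` differentiable at `x` this is `df(X x) = c`. It also makes sense for functions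
that are only leaf-wise differentiable, if `X` is tangent to the leaves: the integral
curves of `X` stay inside the leaves, and this is the derivative of the restriction of `f` to
the leaf with respect to the restriction of `X`. -/
def HasDerivAlong (X : VField m M) (f : M → ℝ) (x : M) (c : ℝ) : Prop :=
  ∃ γ : ℝ → M, γ 0 = x ∧ IsMIntegralCurveAt (I := 𝓡 m) γ X 0 ∧ HasDerivAt (fun t => f (γ t)) c 0

end Manifold

/-- A big-isotropic structure of rank `k` on the `m`-dimensional manifold `M`: a smooth
`g`-isotropic subbundle of rank `k` of the big tangent bundle. -/
structure BigIsotropic (m k : ℕ) (M : Type*) [TopologicalSpace M] [ChartedSpace (Model m) M]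
    [IsManifold (𝓡 m) ∞ M] where
  /-- the fibre of the subbundle at `x` -/
  fiber : (x : M) → Submodule ℝ (BigTangent m M x)
  /-- the fibres have smooth local bases with `k` elements -/
  exists_local_frame : ∀ x₀ : M, ∃ U : Set M, IsOpen U ∧ x₀ ∈ U ∧ ∃ s : Fin k → BigField m M,
    (∀ i, SmoothBigFieldOn (s i) U) ∧
    ∀ x ∈ U, LinearIndependent ℝ (fun i => s i x) ∧
      Submodule.span ℝ (Set.range fun i => s i x) = fiber x
  isotropic : ∀ x, ∀ u ∈ fiber x, ∀ v ∈ fiber x, neutralMetric x u v = 0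

namespace BigIsotropic

variable {m k : ℕ} {M : Type*} [TopologicalSpace M] [ChartedSpace (Model m) M]
  [IsManifold (𝓡 m) ∞ M] (E : BigIsotropic m k M)

/-- The global smooth sections of `E`. -/
def IsSection (s : BigField m M) : Prop :=
  SmoothBigFieldOn s Set.univ ∧ ∀ x, s x ∈ E.fiber x

/-- `E` is integrable if its space of smooth sections is closed by the Courant bracket. -/
def Integrable : Prop :=
  ∀ s t : BigField m M, E.IsSection s → E.IsSection t → E.IsSection (courantBracket s t)

/-- The fibre at `x` of the `g`-orthogonal bundle `E'` of `E`. -/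
def orthFiber (x : M) : Submodule ℝ (BigTangent m M x) :=
  (neutralMetric x).orthogonal (E.fiber x)

/-- The generalized distribution `𝓔 = pr_{TM} E`. -/
def charDist (x : M) : Submodule ℝ (TangentSpace (𝓡 m) x) :=
  (E.fiber x).map (LinearMap.fst ℝ (TangentSpace (𝓡 m) x) (Cotangent m M x))

/-- The generalized distribution `𝓔' = pr_{TM} E'`. -/
def charDist' (x : M) : Submodule ℝ (TangentSpace (𝓡 m) x) :=
  (E.orthFiber x).map (LinearMap.fst ℝ (TangentSpace (𝓡 m) x) (Cotangent m M x))

/-- `E` is almost Dirac, i.e. a maximal isotropic subbundle: its rank is `dim M`. -/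
def IsAlmostDirac (_E : BigIsotropic m k M) : Prop := k = m

/-- `E` is regular: `𝓔` has constant dimension. -/
def IsRegular : Prop := ∃ r : ℕ, ∀ x, Module.finrank ℝ (E.charDist x) = r

open Classical in
/-- The pairing `ϖ_x : 𝓔_x × 𝓔'_x → ℝ`, `ϖ_x(X,Y) = ω((X,α),(Y,β))` where `(X,α) ∈ E_x`,
`(Y,β) ∈ E'_x`; it is extended by `0` outside of `𝓔_x × 𝓔'_x`. -/
def varpi (x : M) (X Y : TangentSpace (𝓡 m) x) : ℝ :=
  if h : ∃ p : Cotangent m M x × Cotangent m M x,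
      ((X, p.1) : BigTangent m M x) ∈ E.fiber x ∧ ((Y, p.2) : BigTangent m M x) ∈ E.orthFiber x
  then bigOmega x (X, h.choose.1) (Y, h.choose.2)
  else 0

theorem add_eq_zero_of_mem {x : M} {X Y : TangentSpace (𝓡 m) x} {α β : Cotangent m M x}
    (hX : ((X, α) : BigTangent m M x) ∈ E.fiber x)
    (hY : ((Y, β) : BigTangent m M x) ∈ E.orthFiber x) : α Y + β X = 0 := by
  have h := LinearMap.BilinForm.mem_orthogonal_iff.1 hY _ hX
  have h' : (α Y + β X) / 2 = 0 := h
  linarith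

/-- The value of `ϖ` does not depend on the choice of `α` and `β`, and
`ϖ(X,Y) = ω((X,α),(Y,β)) = α(Y) = -β(X)`. -/
theorem varpi_eq {x : M} {X Y : TangentSpace (𝓡 m) x} {α β : Cotangent m M x}
    (hX : ((X, α) : BigTangent m M x) ∈ E.fiber x)
    (hY : ((Y, β) : BigTangent m M x) ∈ E.orthFiber x) :
    E.varpi x X Y = bigOmega x (X, α) (Y, β) ∧ E.varpi x X Y = α Y ∧
      E.varpi x X Y = -β X := by
  have h : ∃ p : Cotangent m M x × Cotangent m M x,
      ((X, p.1) : BigTangent m M x) ∈ E.fiber x ∧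
        ((Y, p.2) : BigTangent m M x) ∈ E.orthFiber x := ⟨(α, β), hX, hY⟩
  have e : E.varpi x X Y = (h.choose.1 Y - h.choose.2 X) / 2 := dif_pos h
  have o : bigOmega x (X, α) (Y, β) = (α Y - β X) / 2 := rfl
  have h1 := E.add_eq_zero_of_mem h.choose_spec.1 h.choose_spec.2
  have h2 := E.add_eq_zero_of_mem hX h.choose_spec.2
  have h3 := E.add_eq_zero_of_mem hX hY
  refine ⟨?_, ?_, ?_⟩ <;> linarith

/-- `𝓔` is involutive. -/
def IsInvolutive : Prop :=
  ∀ X₁ X₂ : VField m M, IsSmoothFieldIn X₁ E.charDist → IsSmoothFieldIn X₂ E.charDist →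
    ∀ x, VectorField.mlieBracket (𝓡 m) X₁ X₂ x ∈ E.charDist x

/-- `𝓔'` is invariant by Lie brackets with the vector fields of `𝓔`. -/
def IsInvariant : Prop :=
  ∀ X Y : VField m M, IsSmoothFieldIn X E.charDist → IsSmoothFieldIn Y E.charDist' →
    ∀ x, VectorField.mlieBracket (𝓡 m) X Y x ∈ E.charDist' x

/-- At `x`, the expression
`d_tr ϖ(X₁,X₂,Y) = X₁ ϖ(X₂,Y) - X₂ ϖ(X₁,Y) + Y ϖ(X₁,X₂)
  - ϖ([X₁,X₂],Y) + ϖ([X₁,Y],X₂) - ϖ([X₂,Y],X₁)`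
makes sense and has value `c`. Here `ϖ(Z,X)` means `-ϖ(X,Z)` for `Z` in `𝓔'`, `X` in `𝓔`. -/
def HasDtrVarpi (X₁ X₂ Y : VField m M) (x : M) (c : ℝ) : Prop :=
  ∃ a₁ a₂ a₃ : ℝ,
    HasDerivAlong X₁ (fun y => E.varpi y (X₂ y) (Y y)) x a₁ ∧
    HasDerivAlong X₂ (fun y => E.varpi y (X₁ y) (Y y)) x a₂ ∧
    HasDerivAlong Y (fun y => E.varpi y (X₁ y) (X₂ y)) x a₃ ∧
    VectorField.mlieBracket (𝓡 m) X₁ X₂ x ∈ E.charDist x ∧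
    VectorField.mlieBracket (𝓡 m) X₁ Y x ∈ E.charDist' x ∧
    VectorField.mlieBracket (𝓡 m) X₂ Y x ∈ E.charDist' x ∧
    c = a₁ - a₂ + a₃
      - E.varpi x (VectorField.mlieBracket (𝓡 m) X₁ X₂ x) (Y x)
      - E.varpi x (X₂ x) (VectorField.mlieBracket (𝓡 m) X₁ Y x)
      + E.varpi x (X₁ x) (VectorField.mlieBracket (𝓡 m) X₂ Y x)

end BigIsotropic

end BigIso

end

noncomputable section

namespace BigIso

/-! For sections σ₁ = (X₁, α₁) and σ₂ = (X₂, α₂) of E, isotropy turns the exact term of the Courant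
bracket into d(α₁(X₂)). Cartan's formula then shows that the covector part of [σ₁, σ₂] takes on a
field Y of 𝓔' the value of d_tr ϖ(X₁, X₂, Y) without its summand -ϖ([X₁, X₂], Y). So, when [X₁, X₂]
is in 𝓔, the vanishing of d_tr ϖ says that [σ₁, σ₂] is g-orthogonal to the elements of E' over Y.
Since smooth sections of E' pass through all its elements and E'' = E, conditions (a), (b), (c) give
integrability (`integrable_of_hasDtrVarpi`); neither maximality nor regularity matters here.

In the other direction the difficulty is that dim 𝓔 may jump, so that a smooth field X of 𝓔 need not
be the projection of a smooth section of E. `exists_lift` produces a section σ with pr σ = X only at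
the points y near x where dim 𝓔_y ≤ dim 𝓔_x. For integrable E these points contain the integral
curves through x of the fields of 𝓔 (`exists_curve`). The reason is a Gronwall estimate
(`eventually_finrank_range_le`): if S is the projection to TM of a frame of E and L an approximate
lift, the defect A = S - SLS vanishes near x exactly where dim 𝓔 does not exceed its value at x, and
its derivative along the curve is bounded by a multiple of A, because brackets of projected sections
stay in 𝓔.

All terms of d_tr ϖ at x can be computed along such curves: the derivatives by definition, the
brackets because [X, W] is 0 at x when W vanishes on the integral curve of X. Hence the fields may
be replaced by their lifts, and integrability gives involutivity and d_tr ϖ = 0 on 𝓔. For an almost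
Dirac structure 𝓔' = 𝓔 and nothing is left. For regular E the lifts are exact near x, and (b)
remains: 𝓔' is the annihilator of E ∩ T*M, a covector α of E ∩ T*M at x extends near x to a section
ρ of E without vector part, and the Courant bracket of ρ with a lift of X again lies in E ∩ T*M at
x; its value on Y is, up to sign, α([X, Y]). -/

theorem contDiffAt_congr_eventuallyEq {F G : Type*} [NormedAddCommGroup F] [NormedSpace ℝ F]
    [NormedAddCommGroup G] [NormedSpace ℝ G] {f g : F → G} {x : F} {n : WithTop ℕ∞}
    (h : f =ᶠ[𝓝 x] g) : ContDiffAt ℝ n f x ↔ ContDiffAt ℝ n g x :=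
  ⟨fun H => H.congr_of_eventuallyEq h.symm, fun H => H.congr_of_eventuallyEq h⟩

/-! ### Fields and forms in the preferred charts. -/

section Chart

variable {m : ℕ} {M : Type*} [TopologicalSpace M] [ChartedSpace (Model m) M]
  [IsManifold (𝓡 m) ∞ M]

/-- The differential at `y` of the preferred chart at `x`. -/
def toModel (x y : M) : TangentSpace (𝓡 m) y →L[ℝ] Model m :=
  (trivializationAt (Model m) (TangentSpace (𝓡 m)) x).continuousLinearMapAt ℝ y

/-- The inverse of the differential at `y` of the preferred chart at `x`. -/
def fromModel (x y : M) : Model m →L[ℝ] TangentSpace (𝓡 m) y :=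
  (trivializationAt (Model m) (TangentSpace (𝓡 m)) x).symmL ℝ y

theorem fromModel_toModel {x y : M} (hy : y ∈ (chartAt (Model m) x).source)
    (v : TangentSpace (𝓡 m) y) : fromModel x y (toModel x y v) = v :=
  (trivializationAt (Model m) (TangentSpace (𝓡 m)) x).symmL_continuousLinearMapAt hy v

theorem toModel_fromModel {x y : M} (hy : y ∈ (chartAt (Model m) x).source)
    (v : Model m) : toModel x y (fromModel x y v) = v :=
  (trivializationAt (Model m) (TangentSpace (𝓡 m)) x).continuousLinearMapAt_symmL hy v

theorem toModel_eq_mfderiv {x y : M} (hy : y ∈ (chartAt (Model m) x).source) :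
    toModel x y = mfderiv (𝓡 m) 𝓘(ℝ, Model m) (extChartAt (𝓡 m) x) y :=
  TangentBundle.continuousLinearMapAt_trivializationAt hy

theorem mfderiv_symm_eq_fromModel {x : M} {p : Model m} (hp : p ∈ (extChartAt (𝓡 m) x).target) :
    mfderiv 𝓘(ℝ, Model m) (𝓡 m) (extChartAt (𝓡 m) x).symm p =
      fromModel x ((extChartAt (𝓡 m) x).symm p) := by
  have h : (extChartAt (𝓡 m) x).symm p ∈ (chartAt (Model m) x).source := by
    simpa using (extChartAt (𝓡 m) x).map_target hp
  have := TangentBundle.symmL_trivializationAt (I := 𝓡 m) h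
  rw [ModelWithCorners.range_eq_univ, mfderivWithin_univ, (extChartAt (𝓡 m) x).right_inv hp] at this
  exact this.symm

theorem chartField_eq (X : VField m M) {x : M} {p : Model m}
    (hp : p ∈ (extChartAt (𝓡 m) x).target) :
    chartField X x p = toModel x ((extChartAt (𝓡 m) x).symm p)
      (X ((extChartAt (𝓡 m) x).symm p)) := by
  have h : (extChartAt (𝓡 m) x).symm p ∈ (chartAt (Model m) x).source := by
    simpa using (extChartAt (𝓡 m) x).map_target hp
  rw [chartField, VectorField.mpullback_apply, mfderiv_symm_eq_fromModel hp]
  have hi : (fromModel (m := m) x ((extChartAt (𝓡 m) x).symm p)).inverse =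
      toModel x ((extChartAt (𝓡 m) x).symm p) := by
    apply ContinuousLinearMap.inverse_eq
    · exact ContinuousLinearMap.ext fun v => fromModel_toModel h v
    · exact ContinuousLinearMap.ext fun v => toModel_fromModel h v
  exact congrArg (fun L => L (X ((extChartAt (𝓡 m) x).symm p))) hi

theorem chartForm_eq (β : OneForm m M) {x : M} {p : Model m}
    (hp : p ∈ (extChartAt (𝓡 m) x).target) :
    chartForm β x p = (β ((extChartAt (𝓡 m) x).symm p)).comp
      (fromModel x ((extChartAt (𝓡 m) x).symm p)) := by
  rw [chartForm, mfderiv_symm_eq_fromModel hp]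

theorem contMDiffAt_iff_contDiffAt_comp_symm {F : Type*} [NormedAddCommGroup F] [NormedSpace ℝ F]
    (f : M → F) {x y : M} (hy : y ∈ (chartAt (Model m) x).source) :
    ContMDiffAt (𝓡 m) 𝓘(ℝ, F) ∞ f y ↔
      ContDiffAt ℝ ∞ (f ∘ (extChartAt (𝓡 m) x).symm) (extChartAt (𝓡 m) x y) := by
  rw [contMDiffAt_iff_source_of_mem_source hy, ModelWithCorners.range_eq_univ,
    contMDiffWithinAt_univ, contMDiffAt_iff_contDiffAt]

theorem contMDiffAt_vField_iff (X : VField m M) {x y : M}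
    (hy : y ∈ (chartAt (Model m) x).source) :
    ContMDiffAt (𝓡 m) ((𝓡 m).prod 𝓘(ℝ, Model m)) ∞
      (fun x => Bundle.TotalSpace.mk' (Model m) (E := fun x : M => TangentSpace (𝓡 m) x) x (X x)) y
      ↔ ContDiffAt ℝ ∞ (chartField X x) (extChartAt (𝓡 m) x y) := by
  rw [(trivializationAt (Model m) (TangentSpace (𝓡 m)) x).contMDiffAt_section_iff hy,
    contMDiffAt_iff_contDiffAt_comp_symm _ hy]
  apply contDiffAt_congr_eventuallyEq
  have hy' : y ∈ (extChartAt (𝓡 m) x).source := by simpa using hy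
  filter_upwards [(isOpen_extChartAt_target x).mem_nhds ((extChartAt (𝓡 m) x).map_source hy')]
    with p hp
  rw [chartField_eq X hp]
  have h : (extChartAt (𝓡 m) x).symm p ∈ (chartAt (Model m) x).source := by
    simpa using (extChartAt (𝓡 m) x).map_target hp
  exact ((trivializationAt (Model m) (TangentSpace (𝓡 m)) x).continuousLinearMapAt_apply_of_mem
    (R := ℝ) h _).symm

theorem contMDiffAt_oneForm_iff (α : OneForm m M) {x y : M}
    (hy : y ∈ (chartAt (Model m) x).source) :
    ContMDiffAt (𝓡 m) ((𝓡 m).prod 𝓘(ℝ, Model m →L[ℝ] ℝ)) ∞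
      (fun x => Bundle.TotalSpace.mk' (Model m →L[ℝ] ℝ)
        (E := fun x : M => TangentSpace (𝓡 m) x →L[ℝ] Bundle.Trivial M ℝ x) x (α x)) y
      ↔ ContDiffAt ℝ ∞ (chartForm α x) (extChartAt (𝓡 m) x y) := by
  have hy2 : y ∈ (trivializationAt (Model m →L[ℝ] ℝ)
      (fun x : M => TangentSpace (𝓡 m) x →L[ℝ] Bundle.Trivial M ℝ x) x).baseSet := ⟨hy, trivial⟩
  rw [(trivializationAt (Model m →L[ℝ] ℝ)
      (fun x : M => TangentSpace (𝓡 m) x →L[ℝ] Bundle.Trivial M ℝ x) x).contMDiffAt_section_iff hy2,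
    contMDiffAt_iff_contDiffAt_comp_symm _ hy]
  apply contDiffAt_congr_eventuallyEq
  have hy' : y ∈ (extChartAt (𝓡 m) x).source := by simpa using hy
  filter_upwards [(isOpen_extChartAt_target x).mem_nhds ((extChartAt (𝓡 m) x).map_source hy')]
    with p hp
  rw [chartForm_eq α hp]
  have h : (extChartAt (𝓡 m) x).symm p ∈ (chartAt (Model m) x).source := by
    simpa using (extChartAt (𝓡 m) x).map_target hp
  ext v
  simp [Function.comp, hom_trivializationAt_apply, ContinuousLinearMap.inCoordinates, fromModel]
  rfl

end Chart

section Charts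

variable {m : ℕ} {M : Type*} [TopologicalSpace M] [ChartedSpace (Model m) M]

theorem mem_chartSource_of_mem_target {x : M} {p : Model m}
    (hp : p ∈ (extChartAt (𝓡 m) x).target) :
    (extChartAt (𝓡 m) x).symm p ∈ (chartAt (Model m) x).source := by
  simpa using (extChartAt (𝓡 m) x).map_target hp

theorem eventually_mem_target (x : M) :
    ∀ᶠ p in 𝓝 (extChartAt (𝓡 m) x x), p ∈ (extChartAt (𝓡 m) x).target :=
  extChartAt_target_mem_nhds x

theorem eventually_symm_mem {x : M} {U : Set M} (hU : U ∈ 𝓝 x) :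
    ∀ᶠ p in 𝓝 (extChartAt (𝓡 m) x x), (extChartAt (𝓡 m) x).symm p ∈ U := by
  have h := continuousAt_extChartAt_symm (I := 𝓡 m) x
  rw [ContinuousAt, extChartAt_to_inv] at h
  exact h hU

theorem contDiffAt_pairing {x : M} {α : OneForm m M} {X : VField m M} {p : Model m}
    (hα : ContDiffAt ℝ ∞ (chartForm α x) p) (hX : ContDiffAt ℝ ∞ (chartField X x) p) :
    ContDiffAt ℝ ∞ (fun p => chartForm α x p (chartField X x p)) p :=
  hα.clm_apply hX

end Charts

/-! ### Smoothness, Lie brackets and Cartan's formula in charts. -/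

section Transfer

variable {m : ℕ} {M : Type*} [TopologicalSpace M] [ChartedSpace (Model m) M]
  [IsManifold (𝓡 m) ∞ M]

theorem SmoothVFieldOn.eventually_contDiffAt {X : VField m M} {U : Set M} {x : M}
    (hX : SmoothVFieldOn X U) (hU : IsOpen U) (hx : x ∈ U) :
    ∀ᶠ p in 𝓝 (extChartAt (𝓡 m) x x), ContDiffAt ℝ ∞ (chartField X x) p := by
  filter_upwards [eventually_mem_target x, eventually_symm_mem (hU.mem_nhds hx)] with p hp hpU
  have := (contMDiffAt_vField_iff X (mem_chartSource_of_mem_target hp)).1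
    (hX.contMDiffAt (hU.mem_nhds hpU))
  rwa [(extChartAt (𝓡 m) x).right_inv hp] at this

theorem SmoothOneFormOn.eventually_contDiffAt {α : OneForm m M} {U : Set M} {x : M}
    (hα : SmoothOneFormOn α U) (hU : IsOpen U) (hx : x ∈ U) :
    ∀ᶠ p in 𝓝 (extChartAt (𝓡 m) x x), ContDiffAt ℝ ∞ (chartForm α x) p := by
  filter_upwards [eventually_mem_target x, eventually_symm_mem (hU.mem_nhds hx)] with p hp hpU
  have := (contMDiffAt_oneForm_iff α (mem_chartSource_of_mem_target hp)).1
    (hα.contMDiffAt (hU.mem_nhds hpU))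
  rwa [(extChartAt (𝓡 m) x).right_inv hp] at this

theorem SmoothVFieldOn.contDiffAt {X : VField m M} (hX : SmoothVFieldOn X Set.univ) (x : M) :
    ContDiffAt ℝ ∞ (chartField X x) (extChartAt (𝓡 m) x x) :=
  (hX.eventually_contDiffAt isOpen_univ (Set.mem_univ x)).self_of_nhds

theorem SmoothOneFormOn.contDiffAt {α : OneForm m M} (hα : SmoothOneFormOn α Set.univ) (x : M) :
    ContDiffAt ℝ ∞ (chartForm α x) (extChartAt (𝓡 m) x x) :=
  (hα.eventually_contDiffAt isOpen_univ (Set.mem_univ x)).self_of_nhds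

theorem smoothOneFormOn_univ_of_contDiffAt {α : OneForm m M}
    (h : ∀ x, ContDiffAt ℝ ∞ (chartForm α x) (extChartAt (𝓡 m) x x)) :
    SmoothOneFormOn α Set.univ := fun x _ =>
  ((contMDiffAt_oneForm_iff α (mem_chart_source (Model m) x)).2 (h x)).contMDiffWithinAt

/-- The smoothness of a vector field, as the differentiability of a section. -/
theorem SmoothVFieldOn.contMDiffAt' {X : VField m M} (hX : SmoothVFieldOn X Set.univ) (x : M) :
    ContMDiffAt (𝓡 m) ((𝓡 m).prod 𝓘(ℝ, Model m)) ∞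
    (fun x => Bundle.TotalSpace.mk' (Model m) (E := fun x : M => TangentSpace (𝓡 m) x) x (X x)) x :=
  ContMDiffOn.contMDiffAt hX Filter.univ_mem

theorem SmoothVFieldOn.mdifferentiableAt {X : VField m M} (hX : SmoothVFieldOn X Set.univ)
    (x : M) : MDifferentiableAt (𝓡 m) ((𝓡 m).prod 𝓘(ℝ, Model m))
    (fun x => Bundle.TotalSpace.mk' (Model m) (E := fun x : M => TangentSpace (𝓡 m) x) x (X x)) x :=
  (hX.contMDiffAt' x).mdifferentiableAt (by simp)

theorem SmoothVFieldOn.sub {X Y : VField m M} (hX : SmoothVFieldOn X Set.univ)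
    (hY : SmoothVFieldOn Y Set.univ) : SmoothVFieldOn (X - Y) Set.univ :=
  ContMDiffOn.sub_section hX hY

theorem SmoothOneFormOn.sub {α β : OneForm m M} (hα : SmoothOneFormOn α Set.univ)
    (hβ : SmoothOneFormOn β Set.univ) : SmoothOneFormOn (α - β) Set.univ :=
  ContMDiffOn.sub_section hα hβ

theorem isManifold_minSmoothness_two (m : ℕ) (M : Type*) [TopologicalSpace M]
    [ChartedSpace (Model m) M] [IsManifold (𝓡 m) ∞ M] : IsManifold (𝓡 m) (minSmoothness ℝ 2) M :=
  IsManifold.of_le (n := ∞) (by simpa using ENat.LEInfty.out)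

theorem isManifold_minSmoothness_three (m : ℕ) (M : Type*) [TopologicalSpace M]
    [ChartedSpace (Model m) M] [IsManifold (𝓡 m) ∞ M] : IsManifold (𝓡 m) (minSmoothness ℝ 3) M :=
  IsManifold.of_le (n := ∞) (by simpa using ENat.LEInfty.out)

theorem SmoothVFieldOn.mlieBracket {X Y : VField m M} (hX : SmoothVFieldOn X Set.univ)
    (hY : SmoothVFieldOn Y Set.univ) :
    SmoothVFieldOn (VectorField.mlieBracket (𝓡 m) X Y) Set.univ := fun x _ => by
  have : IsManifold (𝓡 m) (((⊤ : ℕ∞) : WithTop ℕ∞) + 1) M := by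
    simpa using (inferInstance : IsManifold (𝓡 m) ∞ M)
  have := isManifold_minSmoothness_two m M
  exact (ContMDiffAt.mlieBracket_vectorField (m := ⊤) (n := ⊤) (hX.contMDiffAt' x)
    (hY.contMDiffAt' x) (by simp)).contMDiffWithinAt

theorem chartField_mlieBracket {X Y : VField m M} (hX : SmoothVFieldOn X Set.univ)
    (hY : SmoothVFieldOn Y Set.univ) {x : M} {p : Model m}
    (hp : p ∈ (extChartAt (𝓡 m) x).target) :
    chartField (VectorField.mlieBracket (𝓡 m) X Y) x p =
      VectorField.lieBracket ℝ (chartField X x) (chartField Y x) p := by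
  have := isManifold_minSmoothness_three m M
  rw [chartField, VectorField.mpullback_mlieBracket (n := ∞) (hX.mdifferentiableAt _)
    (hY.mdifferentiableAt _), ← VectorField.mlieBracketWithin_univ,
    VectorField.mlieBracketWithin_eq_lieBracketWithin]
  · exact congrFun (VectorField.lieBracketWithin_univ (𝕜 := ℝ) (V := chartField X x)
      (W := chartField Y x)) p
  · exact (contMDiffOn_extChartAt_symm x).contMDiffAt
      ((isOpen_extChartAt_target x).mem_nhds hp)
  · simpa using ENat.LEInfty.out

theorem pairing_comp_symm {x : M} (α : OneForm m M) (X : VField m M) {p : Model m}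
    (hp : p ∈ (extChartAt (𝓡 m) x).target) :
    α ((extChartAt (𝓡 m) x).symm p) (X ((extChartAt (𝓡 m) x).symm p)) =
      chartForm α x p (chartField X x p) := by
  rw [chartForm_eq α hp, chartField_eq X hp, ContinuousLinearMap.comp_apply,
    fromModel_toModel (mem_chartSource_of_mem_target hp)]

theorem contMDiff_pairing {α : OneForm m M} {X : VField m M} (hα : SmoothOneFormOn α Set.univ)
    (hX : SmoothVFieldOn X Set.univ) :
    ContMDiff (𝓡 m) 𝓘(ℝ, ℝ) ∞ (fun y => α y (X y)) := fun x => by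
  rw [contMDiffAt_iff_contDiffAt_comp_symm _ (mem_chart_source (Model m) x)]
  refine (contDiffAt_pairing (hα.contDiffAt x) (hX.contDiffAt x)).congr_of_eventuallyEq ?_
  filter_upwards [eventually_mem_target x] with p hp using pairing_comp_symm α X hp

/-- The differential of a function in the preferred chart. -/
theorem dFun_eq_fderiv_comp {f : M → ℝ} {x y : M} (hf : ContMDiffAt (𝓡 m) 𝓘(ℝ, ℝ) ∞ f y)
    (hy : y ∈ (chartAt (Model m) x).source) (v : TangentSpace (𝓡 m) y) :
    dFun f y v =
      fderiv ℝ (f ∘ (extChartAt (𝓡 m) x).symm) (extChartAt (𝓡 m) x y) (toModel x y v) := by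
  rw [toModel_eq_mfderiv hy]
  have hF := (contMDiffAt_iff_contDiffAt_comp_symm f hy).1 hf
  have hF' : MDifferentiableAt 𝓘(ℝ, Model m) 𝓘(ℝ, ℝ) (f ∘ (extChartAt (𝓡 m) x).symm)
      (extChartAt (𝓡 m) x y) := (hF.differentiableAt (by simp)).mdifferentiableAt
  have hφ := mdifferentiableAt_extChartAt (I := 𝓡 m) hy
  have key := mfderiv_comp y hF' hφ
  have he : (f ∘ (extChartAt (𝓡 m) x).symm) ∘ (extChartAt (𝓡 m) x) =ᶠ[𝓝 y] f := by
    filter_upwards [(isOpen_extChartAt_source (I := 𝓡 m) x).mem_nhds (by rwa [extChartAt_source])]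
      with z hz
    simp only [Function.comp, (extChartAt (𝓡 m) x).left_inv hz]
  rw [he.mfderiv_eq, mfderiv_eq_fderiv] at key
  exact congrArg (fun L => L v) key

/-- Cartan's formula `(L_X β)(Y) = X(β(Y)) - β([X,Y])`. -/
theorem lieDerivForm_apply {X Y : VField m M} {β : OneForm m M}
    (hX : SmoothVFieldOn X Set.univ) (hβ : SmoothOneFormOn β Set.univ)
    (hY : SmoothVFieldOn Y Set.univ) (x : M) :
    lieDerivForm X β x (Y x) = dFun (fun y => β y (Y y)) x (X x)
      - β x (VectorField.mlieBracket (𝓡 m) X Y x) := by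
  have hp := mem_extChartAt_target (I := 𝓡 m) x
  have hs := mem_chart_source (Model m) x
  have hb : β x (VectorField.mlieBracket (𝓡 m) X Y x) =
      chartForm β x (extChartAt (𝓡 m) x x)
        (VectorField.lieBracket ℝ (chartField X x) (chartField Y x) (extChartAt (𝓡 m) x x)) := by
    rw [← chartField_mlieBracket hX hY hp, ← pairing_comp_symm β _ hp, extChartAt_to_inv]
  have hc : ∀ Z : VField m M, toModel x x (Z x) = chartField Z x (extChartAt (𝓡 m) x x) := by
    intro Z
    rw [chartField_eq Z hp, extChartAt_to_inv]
  have hf : fderiv ℝ ((fun y => β y (Y y)) ∘ (extChartAt (𝓡 m) x).symm) (extChartAt (𝓡 m) x x) =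
      fderiv ℝ (fun p => chartForm β x p (chartField Y x p)) (extChartAt (𝓡 m) x x) := by
    apply Filter.EventuallyEq.fderiv_eq
    filter_upwards [eventually_mem_target x] with p hp using pairing_comp_symm β Y hp
  -- By the product rule, the derivative of β(Y) along X contains β(DY·X), which cancels against the
  -- same term of β([X, Y]) = β(DY·X - DX·Y).
  rw [dFun_eq_fderiv_comp (contMDiff_pairing hβ hY x) hs, hf, hb, lieDerivForm,
    ← toModel_eq_mfderiv hs, fderiv_clm_apply ((hβ.contDiffAt x).differentiableAt (by simp))
      ((hY.contDiffAt x).differentiableAt (by simp)), VectorField.lieBracket]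
  simp only [ContinuousLinearMap.comp_apply, add_apply, hc,
    ContinuousLinearMap.flip_apply, map_sub]
  ring

end Transfer

section Charts

variable {m : ℕ} {M : Type*} [TopologicalSpace M] [ChartedSpace (Model m) M]

/-- The preimage under the chart of an eventual property. -/
theorem eventually_chart {x : M} {P : Model m → Prop}
    (h : ∀ᶠ p in 𝓝 (extChartAt (𝓡 m) x x), P p) : ∀ᶠ y in 𝓝 x, P (extChartAt (𝓡 m) x y) :=
  (continuousAt_extChartAt (I := 𝓡 m) x).eventually h

end Charts

/-! ### Global extension of local sections. -/

section Extension

variable {m : ℕ} {M : Type*} [TopologicalSpace M] [ChartedSpace (Model m) M]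
  [IsManifold (𝓡 m) ∞ M]

/-- The model fibre of the big tangent bundle. -/
abbrev BigModel (m : ℕ) : Type := Model m × (Model m →L[ℝ] ℝ)

/-- The preferred chart at `x` identifies the big tangent space at `y` with the model. -/
def toBigModel (x y : M) : BigTangent m M y →ₗ[ℝ] BigModel m where
  toFun u := (toModel x y u.1, u.2.comp (fromModel x y))
  map_add' u v := by
    refine Prod.ext (map_add _ _ _) ?_
    ext w
    rfl
  map_smul' c u := by
    refine Prod.ext (map_smul _ _ _) ?_
    ext w
    rfl

/-- The inverse of `toBigModel`. -/
def fromBigModel (x y : M) : BigModel m →ₗ[ℝ] BigTangent m M y where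
  toFun u := (fromModel x y u.1, u.2.comp (toModel x y))
  map_add' u v := by
    refine Prod.ext (map_add _ _ _) ?_
    ext w
    rfl
  map_smul' c u := by
    refine Prod.ext (map_smul _ _ _) ?_
    ext w
    rfl

theorem fromBigModel_toBigModel {x y : M} (hy : y ∈ (chartAt (Model m) x).source)
    (u : BigTangent m M y) : fromBigModel x y (toBigModel x y u) = u := by
  refine Prod.ext (fromModel_toModel hy u.1) ?_
  exact ContinuousLinearMap.ext fun w => congrArg u.2 (fromModel_toModel hy w)

theorem toBigModel_fromBigModel {x y : M} (hy : y ∈ (chartAt (Model m) x).source)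
    (u : BigModel m) : toBigModel x y (fromBigModel x y u) = u := by
  refine Prod.ext (toModel_fromModel hy u.1) ?_
  exact ContinuousLinearMap.ext fun w => congrArg u.2 (toModel_fromModel hy w)

/-- The representative of a section of the big tangent bundle in the preferred chart at `x`. -/
def chartBig (s : BigField m M) (x : M) (p : Model m) : BigModel m :=
  (chartField (fun y => (s y).1) x p, chartForm (fun y => (s y).2) x p)

theorem chartBig_eq (s : BigField m M) {x : M} {p : Model m}
    (hp : p ∈ (extChartAt (𝓡 m) x).target) :
    chartBig s x p = toBigModel x ((extChartAt (𝓡 m) x).symm p)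
      (s ((extChartAt (𝓡 m) x).symm p)) :=
  Prod.ext (chartField_eq (fun y => (s y).1) hp) (chartForm_eq (fun y => (s y).2) hp)

theorem chartBig_self (s : BigField m M) (x : M) :
    chartBig s x (extChartAt (𝓡 m) x x) = toBigModel x x (s x) := by
  rw [chartBig_eq s (mem_extChartAt_target x), extChartAt_to_inv]

theorem chartField_self (X : VField m M) (x : M) :
    chartField X x (extChartAt (𝓡 m) x x) = toModel x x (X x) := by
  rw [chartField_eq X (mem_extChartAt_target x), extChartAt_to_inv]

theorem fromBigModel_chartBig (s : BigField m M) {x : M} {p : Model m}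
    (hp : p ∈ (extChartAt (𝓡 m) x).target) :
    fromBigModel x ((extChartAt (𝓡 m) x).symm p) (chartBig s x p) =
      s ((extChartAt (𝓡 m) x).symm p) := by
  rw [chartBig_eq s hp, fromBigModel_toBigModel (mem_chartSource_of_mem_target hp)]

theorem SmoothBigFieldOn.eventually_contDiffAt {s : BigField m M} {U : Set M} {x : M}
    (hs : SmoothBigFieldOn s U) (hU : IsOpen U) (hx : x ∈ U) :
    ∀ᶠ p in 𝓝 (extChartAt (𝓡 m) x x), ContDiffAt ℝ ∞ (chartBig s x) p := by
  filter_upwards [hs.1.eventually_contDiffAt hU hx, hs.2.eventually_contDiffAt hU hx]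
    with p h1 h2 using h1.prodMk h2

/-- A local section, given in a chart, of a family `D` of subspaces of the big tangent spaces
coincides near the centre of the chart with a global section of `D`. -/
theorem exists_global_extension [T2Space M] (D : ∀ y : M, Submodule ℝ (BigTangent m M y)) (x : M)
    {f : Model m → BigModel m}
    (hf : ∀ᶠ p in 𝓝 (extChartAt (𝓡 m) x x), ContDiffAt ℝ ∞ f p)
    (hD : ∀ᶠ p in 𝓝 (extChartAt (𝓡 m) x x),
      fromBigModel x ((extChartAt (𝓡 m) x).symm p) (f p) ∈ D ((extChartAt (𝓡 m) x).symm p)) :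
    ∃ s : BigField m M, SmoothBigFieldOn s Set.univ ∧ (∀ y, s y ∈ D y) ∧
      ∀ᶠ p in 𝓝 (extChartAt (𝓡 m) x x), chartBig s x p = f p := by
  have hW := (eventually_chart hf).and ((eventually_chart hD).and
    (extChartAt_source_mem_nhds (I := 𝓡 m) x))
  obtain ⟨U, hU, hUo, hxU⟩ := mem_nhds_iff.1 hW
  obtain ⟨ρ, -, hρ⟩ := (SmoothBumpFunction.nhds_basis_tsupport (I := 𝓡 m) x).mem_iff.1
    (hUo.mem_nhds hxU)
  let t : BigField m M := fun y => fromBigModel x y (f (extChartAt (𝓡 m) x y))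
  have ht : ∀ p ∈ (extChartAt (𝓡 m) x).target, chartBig t x p = f p := by
    intro p hp
    rw [chartBig_eq t hp]
    simp only [t, toBigModel_fromBigModel (mem_chartSource_of_mem_target hp),
      (extChartAt (𝓡 m) x).right_inv hp]
  have htev : ∀ y ∈ U, chartBig t x =ᶠ[𝓝 (extChartAt (𝓡 m) x y)] f := by
    intro y hy
    filter_upwards [(isOpen_extChartAt_target x).mem_nhds ((extChartAt (𝓡 m) x).map_source
      (hU hy).2.2)] with p hp using ht p hp
  have htc : ∀ y ∈ U, ContDiffAt ℝ ∞ (chartBig t x) (extChartAt (𝓡 m) x y) := fun y hy =>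
    (hU hy).1.congr_of_eventuallyEq (htev y hy)
  have hsrc : ∀ y ∈ U, y ∈ (chartAt (Model m) x).source := fun y hy => by
    have h : y ∈ (extChartAt (𝓡 m) x).source := (hU hy).2.2
    rwa [extChartAt_source] at h
  have h1 : SmoothVFieldOn (fun y => (t y).1) U := fun y hy =>
    ((contMDiffAt_vField_iff (fun y => (t y).1) (hsrc y hy)).2 (htc y hy).fst).contMDiffWithinAt
  have h2 : SmoothOneFormOn (fun y => (t y).2) U := fun y hy =>
    ((contMDiffAt_oneForm_iff (fun y => (t y).2) (hsrc y hy)).2 (htc y hy).snd).contMDiffWithinAt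
  -- Multiplication by the bump function stays in each subspace `D y`, so no regularity of `D` is
  -- needed; outside `U` the product is 0.
  refine ⟨fun y => ρ y • t y, ⟨?_, ?_⟩, ?_, ?_⟩
  · exact (ContMDiffOn.smul_section_of_tsupport ρ.contMDiff.contMDiffOn hUo hρ h1).contMDiffOn
  · exact (ContMDiffOn.smul_section_of_tsupport ρ.contMDiff.contMDiffOn hUo hρ h2).contMDiffOn
  · intro y
    by_cases hy : y ∈ U
    · have := (hU hy).2.1
      rw [(extChartAt (𝓡 m) x).left_inv (hU hy).2.2] at this
      exact (D y).smul_mem _ this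
    · have : ρ y = 0 := image_eq_zero_of_notMem_tsupport fun h => hy (hρ h)
      simp [this]
  · filter_upwards [eventually_mem_target x, eventually_symm_mem ρ.eventuallyEq_one] with p hp h1
    rw [← ht p hp, chartBig_eq _ hp, chartBig_eq _ hp]
    have h1 : ρ ((extChartAt (𝓡 m) x).symm p) = 1 := h1
    rw [h1, one_smul]

end Extension

/-! ### The Courant bracket of smooth sections. -/

section Courant

variable {m : ℕ} {M : Type*} [TopologicalSpace M] [ChartedSpace (Model m) M]
  [IsManifold (𝓡 m) ∞ M]

/-- The evaluation of the Courant bracket on a vector field. -/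
theorem courantBracket_snd_apply {s t : BigField m M} {Y : VField m M}
    (hs : SmoothBigFieldOn s Set.univ) (ht : SmoothBigFieldOn t Set.univ)
    (hY : SmoothVFieldOn Y Set.univ) (x : M) :
    (courantBracket s t x).2 (Y x) =
      dFun (fun y => (t y).2 (Y y)) x (s x).1
        - (t x).2 (VectorField.mlieBracket (𝓡 m) (fun y => (s y).1) Y x)
      - (dFun (fun y => (s y).2 (Y y)) x (t x).1
        - (s x).2 (VectorField.mlieBracket (𝓡 m) (fun y => (t y).1) Y x))
      + (1 / 2) * dFun (fun y => (s y).2 (t y).1 - (t y).2 (s y).1) x (Y x) := by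
  have h1 := lieDerivForm_apply hs.1 ht.2 hY x
  have h2 := lieDerivForm_apply ht.1 hs.2 hY x
  rw [← h1, ← h2]
  rfl

theorem contMDiff_dFun {f : M → ℝ} (hf : ContMDiff (𝓡 m) 𝓘(ℝ, ℝ) ∞ f) {X : VField m M}
    (hX : SmoothVFieldOn X Set.univ) :
    ContMDiff (𝓡 m) 𝓘(ℝ, ℝ) ∞ (fun y => dFun f y (X y)) := fun x => by
  rw [contMDiffAt_iff_contDiffAt_comp_symm _ (mem_chart_source (Model m) x)]
  have h1 := (contMDiffAt_iff_contDiffAt_comp_symm f (mem_chart_source (Model m) x)).1 (hf x)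
  have h2 : ContDiffAt ℝ ∞ (fderiv ℝ (f ∘ (extChartAt (𝓡 m) x).symm)) (extChartAt (𝓡 m) x x) :=
    h1.fderiv_right (m := ∞) (by simp)
  refine (h2.clm_apply (hX.contDiffAt x)).congr_of_eventuallyEq ?_
  filter_upwards [eventually_mem_target x] with p hp
  rw [Function.comp_apply, dFun_eq_fderiv_comp (hf _) (mem_chartSource_of_mem_target hp),
    (extChartAt (𝓡 m) x).right_inv hp, chartField_eq X hp]

theorem contDiffAt_clm_of_apply {F G K : Type*} [NormedAddCommGroup K] [NormedSpace ℝ K]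
    [NormedAddCommGroup F] [NormedSpace ℝ F]
    [NormedAddCommGroup G] [NormedSpace ℝ G] [FiniteDimensional ℝ G]
    {n : WithTop ℕ∞} {f : F → G →L[ℝ] K} {p : F}
    (h : ∀ v, ContDiffAt ℝ n (fun q => f q v) p) : ContDiffAt ℝ n f p := by
  let e₁ : G ≃L[ℝ] (Fin (Module.finrank ℝ G) → ℝ) :=
    ContinuousLinearEquiv.ofFinrankEq (Module.finrank_fin_fun ℝ).symm
  let e₂ := (e₁.arrowCongr (1 : K ≃L[ℝ] K)).trans (ContinuousLinearEquiv.piRing (Fin _))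
  rw [← Function.id_comp f, ← e₂.symm_comp_self]
  exact e₂.symm.contDiff.contDiffAt.comp p (contDiffAt_pi.2 fun i => h _)

/-- A `1`-form is smooth if its values on smooth vector fields are smooth. -/
theorem smoothOneFormOn_of_apply [T2Space M] {α : OneForm m M}
    (h : ∀ Y : VField m M, SmoothVFieldOn Y Set.univ →
      ContMDiff (𝓡 m) 𝓘(ℝ, ℝ) ∞ (fun y => α y (Y y))) : SmoothOneFormOn α Set.univ := by
  refine smoothOneFormOn_univ_of_contDiffAt fun x => contDiffAt_clm_of_apply fun v => ?_
  -- The test field extends the constant field `v` of the chart, so that α of it is the component of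
  -- the chart form on `v` near the centre.
  obtain ⟨s, hs, -, hsv⟩ := exists_global_extension (fun y : M => ⊤) x
    (f := fun _ => ((v, 0) : BigModel m)) (Filter.Eventually.of_forall fun p => contDiffAt_const)
    (Filter.Eventually.of_forall fun p => trivial)
  have h1 := (contMDiffAt_iff_contDiffAt_comp_symm _ (mem_chart_source (Model m) x)).1
    (h _ hs.1 x)
  refine h1.congr_of_eventuallyEq ?_
  filter_upwards [eventually_mem_target x, hsv] with p hp hpv
  rw [Function.comp_apply, pairing_comp_symm α (fun y => (s y).1) hp,
    show chartField (fun y => (s y).1) x p = v from congrArg Prod.fst hpv]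

theorem SmoothBigFieldOn.courantBracket [T2Space M] {s t : BigField m M}
    (hs : SmoothBigFieldOn s Set.univ) (ht : SmoothBigFieldOn t Set.univ) :
    SmoothBigFieldOn (courantBracket s t) Set.univ := by
  refine ⟨hs.1.mlieBracket ht.1, smoothOneFormOn_of_apply fun Y hY => ?_⟩
  simp only [courantBracket_snd_apply hs ht hY]
  have hst := contMDiff_pairing hs.2 ht.1
  have hts := contMDiff_pairing ht.2 hs.1
  exact (((contMDiff_dFun (contMDiff_pairing ht.2 hY) hs.1).sub
    (contMDiff_pairing ht.2 (hs.1.mlieBracket hY))).sub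
    ((contMDiff_dFun (contMDiff_pairing hs.2 hY) ht.1).sub
    (contMDiff_pairing hs.2 (ht.1.mlieBracket hY)))).add
    (contMDiff_const.mul (contMDiff_dFun (hst.sub hts) hY))

end Courant

/-! ### Smooth inverses of families of linear maps. -/

section LinearFamilies

variable {H F G : Type*} [NormedAddCommGroup H] [NormedSpace ℝ H]
  [NormedAddCommGroup F] [NormedSpace ℝ F] [FiniteDimensional ℝ F]
  [NormedAddCommGroup G] [NormedSpace ℝ G]

/-- The inverse of a smooth family of endomorphisms which is the identity at one point. -/
theorem exists_smooth_inverse {S : H → F →L[ℝ] F} {p : H}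
    (hS : ∀ᶠ q in 𝓝 p, ContDiffAt ℝ ∞ S q) (h1 : S p = 1) :
    ∃ T : H → F →L[ℝ] F, (∀ᶠ q in 𝓝 p, ContDiffAt ℝ ∞ T q) ∧
      ∀ᶠ q in 𝓝 p, S q * T q = 1 ∧ T q * S q = 1 := by
  have : CompleteSpace F := FiniteDimensional.complete ℝ F
  have hu : ∀ᶠ q in 𝓝 p, IsUnit (S q) := by
    have hc : ContinuousAt S p := hS.self_of_nhds.continuousAt
    refine hc.eventually (Units.isOpen.mem_nhds ?_)
    rw [h1]
    exact isUnit_one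
  refine ⟨fun q => Ring.inverse (S q), ?_, ?_⟩
  · filter_upwards [hS, hu] with q hq ⟨u, hu⟩
    exact ContDiffAt.comp q (by rw [← hu]; exact contDiffAt_ringInverse ℝ u) hq
  · filter_upwards [hu] with q hq
    exact ⟨Ring.mul_inverse_cancel _ hq, Ring.inverse_mul_cancel _ hq⟩

/-- A smooth family of linear maps which is surjective at `p` has smooth right inverses near `p`. -/
theorem exists_smooth_rightInverse {S : H → G →L[ℝ] F} {p : H}
    (hS : ∀ᶠ q in 𝓝 p, ContDiffAt ℝ ∞ S q) (hp : Function.Surjective (S p)) :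
    ∃ T : H → F →L[ℝ] G, (∀ᶠ q in 𝓝 p, ContDiffAt ℝ ∞ T q) ∧
      ∀ᶠ q in 𝓝 p, ∀ v, S q (T q v) = v := by
  obtain ⟨R, hR⟩ := (S p).toLinearMap.exists_rightInverse_of_surjective
    (LinearMap.range_eq_top.2 hp)
  let R' : F →L[ℝ] G := LinearMap.toContinuousLinearMap R
  -- With a fixed right inverse `R'` at `p`, the endomorphisms `S q ∘ R'` are the identity at `p`,
  -- hence invertible nearby.
  obtain ⟨T, hT, hST⟩ := exists_smooth_inverse (S := fun q => (S q).comp R') (p := p)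
    (hS.mono fun q hq => hq.clm_comp contDiffAt_const)
    (by ext v; exact LinearMap.congr_fun hR v)
  refine ⟨fun q => R'.comp (T q), hT.mono fun q hq => contDiffAt_const.clm_comp hq, ?_⟩
  filter_upwards [hST] with q hq v
  exact congrArg (fun L => L v) hq.1

/-- A smooth family of linear maps which is injective at `p` has smooth left inverses near `p`. -/
theorem exists_smooth_leftInverse [FiniteDimensional ℝ G] {S : H → G →L[ℝ] F} {p : H}
    (hS : ∀ᶠ q in 𝓝 p, ContDiffAt ℝ ∞ S q) (hp : Function.Injective (S p)) :
    ∃ T : H → F →L[ℝ] G, (∀ᶠ q in 𝓝 p, ContDiffAt ℝ ∞ T q) ∧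
      ∀ᶠ q in 𝓝 p, ∀ v, T q (S q v) = v := by
  obtain ⟨R, hR⟩ := (S p).toLinearMap.exists_leftInverse_of_injective
    (LinearMap.ker_eq_bot.2 hp)
  let R' : F →L[ℝ] G := LinearMap.toContinuousLinearMap R
  obtain ⟨T, hT, hST⟩ := exists_smooth_inverse (S := fun q => R'.comp (S q)) (p := p)
    (hS.mono fun q hq => contDiffAt_const.clm_comp hq)
    (by ext v; exact LinearMap.congr_fun hR v)
  refine ⟨fun q => (T q).comp R', hT.mono fun q hq => hq.clm_comp contDiffAt_const, ?_⟩
  filter_upwards [hST] with q hq v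
  exact congrArg (fun L => L v) hq.2

end LinearFamilies

/-! ### Gronwall and norm estimates. -/

section Gronwall

/-- A curve `b` vanishing at `0`, with `‖b'‖ ≤ C ‖b‖`, vanishes. -/
theorem eventually_eq_zero_of_norm_deriv_le {F : Type*} [NormedAddCommGroup F] [NormedSpace ℝ F]
    {b b' : ℝ → F} {C : ℝ} (h0 : b 0 = 0)
    (hb : ∀ᶠ t in 𝓝 (0 : ℝ), HasDerivAt b (b' t) t ∧ ‖b' t‖ ≤ C * ‖b t‖) :
    ∀ᶠ t in 𝓝 (0 : ℝ), b t = 0 := by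
  obtain ⟨ε, hε, h⟩ := Metric.eventually_nhds_iff_ball.1 hb
  -- Gronwall's inequality is one-sided; σ = -1 reverses time and covers negative `t`.
  have key : ∀ (σ : ℝ), |σ| = 1 → ∀ t, 0 ≤ t → t < ε → b (σ * t) = 0 := by
    intro σ hσ t ht0 htε
    have hmem : ∀ s ∈ Set.Icc 0 t, σ * s ∈ Metric.ball (0 : ℝ) ε := by
      intro s hs
      rw [Metric.mem_ball, dist_zero_right, Real.norm_eq_abs, abs_mul, hσ, one_mul,
        abs_of_nonneg hs.1]
      exact hs.2.trans_lt htε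
    have hd : ∀ s ∈ Set.Icc 0 t, HasDerivAt (fun s => b (σ * s)) (σ • b' (σ * s)) s := by
      intro s hs
      have h1 : HasDerivAt (fun s : ℝ => σ * s) σ s := by
        simpa using (hasDerivAt_id s).const_mul σ
      exact (h _ (hmem s hs)).1.scomp s h1
    refine eq_zero_of_abs_deriv_le_mul_abs_self_of_eq_zero_right (K := C)
      (f := fun s => b (σ * s)) (f' := fun s => σ • b' (σ * s)) (a := 0) (b := t)
      (fun s hs => (hd s hs).continuousAt.continuousWithinAt)
      (fun s hs => (hd s (Set.Ico_subset_Icc_self hs)).hasDerivWithinAt) (by simpa using h0)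
      (fun s hs => ?_) t ⟨ht0, le_rfl⟩
    rw [norm_smul, Real.norm_eq_abs, hσ, one_mul]
    exact (h _ (hmem s (Set.Ico_subset_Icc_self hs))).2
  refine Metric.eventually_nhds_iff_ball.2 ⟨ε, hε, fun t ht => ?_⟩
  rw [Metric.mem_ball, dist_zero_right, Real.norm_eq_abs] at ht
  rcases le_total 0 t with h0t | h0t
  · simpa using key 1 (by simp) t h0t (by rwa [abs_of_nonneg h0t] at ht)
  · simpa using key (-1) (by simp) (-t) (by linarith) (by rwa [abs_of_nonpos h0t] at ht)

end Gronwall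

section Estimates

/-- Bounds `A` by its columns, the quantities for which the differential inequality along a curve is
obtained. -/
theorem norm_apply_le_card_mul {H : Type*} [NormedAddCommGroup H] [NormedSpace ℝ H] {k : ℕ}
    (A : (Fin k → ℝ) →L[ℝ] H) (c : Fin k → ℝ) :
    ‖A c‖ ≤ k * ‖c‖ * ‖fun j => A (Pi.single j 1)‖ := by
  have hc : A c = ∑ j, c j • A (Pi.single j 1) := by
    conv_lhs => rw [pi_eq_sum_univ' c]
    simp [map_sum]
  rw [hc]
  refine (norm_sum_le _ _).trans ?_
  refine (Finset.sum_le_sum (g := fun _ => ‖c‖ * ‖fun j => A (Pi.single j 1)‖) fun j _ => ?_).trans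
    (by simp [mul_assoc])
  rw [norm_smul]
  exact mul_le_mul (norm_le_pi_norm c j) (norm_le_pi_norm (fun j => A (Pi.single j 1)) j)
    (norm_nonneg _) (norm_nonneg _)

theorem exists_eventually_norm_le {X Y : Type*} [TopologicalSpace X] [NormedAddCommGroup Y]
    {f : X → Y} {x : X} (hf : ContinuousAt f x) : ∃ C : ℝ, 0 ≤ C ∧ ∀ᶠ y in 𝓝 x, ‖f y‖ ≤ C :=
  ⟨‖f x‖ + 1, by positivity,
    (hf.norm.eventually_lt_const (lt_add_one _)).mono fun _ h => h.le⟩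

end Estimates

/-! ### Families of linear maps of variable rank. -/

section Adapted

variable {H : Type*} [NormedAddCommGroup H] [NormedSpace ℝ H] [FiniteDimensional ℝ H] {k : ℕ}

/-- A smooth family of lifts `L q` through a family `S q` of linear maps of variable rank, which is
exact at the points where the rank of `S q` is minimal. -/
theorem exists_adapted_lift {S : H → (Fin k → ℝ) →L[ℝ] H} {p : H}
    (hS : ∀ᶠ q in 𝓝 p, ContDiffAt ℝ ∞ S q) :
    ∃ (L : H → H →L[ℝ] (Fin k → ℝ)) (P : H →L[ℝ] H), (∀ᶠ q in 𝓝 p, ContDiffAt ℝ ∞ L q) ∧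
      ∀ᶠ q in 𝓝 p, (∀ v, P (S q (L q v)) = P v) ∧ (∀ v, P v = 0 → L q v = 0) ∧
        (Module.finrank ℝ (S q).range ≤ Module.finrank ℝ (S p).range →
          ∀ c, S q (L q (S q c)) = S q c) ∧
        ((∀ c, S q (L q (S q c)) = S q c) →
          Module.finrank ℝ (S q).range ≤ Module.finrank ℝ (S p).range) := by
  -- Projecting onto the image at `p` makes the family surjective at `p`, hence smoothly
  -- right-invertible nearby; the lift is `L q = T q ∘ P`.
  obtain ⟨P₀, hP₀⟩ := (S p).range.subtype.exists_leftInverse_of_injective (by simp)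
  let P : H →L[ℝ] (S p).range := LinearMap.toContinuousLinearMap P₀
  have hP : ∀ w : (S p).range, P w = w := fun w => LinearMap.congr_fun hP₀ w
  obtain ⟨T, hT, hST⟩ := exists_smooth_rightInverse (S := fun q => P.comp (S q)) (p := p)
    (hS.mono fun q hq => contDiffAt_const.clm_comp hq)
    (by
      rintro ⟨_, c, rfl⟩
      exact ⟨c, hP ⟨S p c, c, rfl⟩⟩)
  refine ⟨fun q => (T q).comp P, (S p).range.subtypeL.comp P,
    hT.mono fun q hq => hq.clm_comp contDiffAt_const, ?_⟩
  filter_upwards [hST] with q hq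
  have hq' : ∀ w, P (S q (T q w)) = w := hq
  refine ⟨fun v => ?_, fun v hv => ?_, fun hr c => ?_, fun h => ?_⟩
  · exact congrArg Subtype.val (hq' (P v))
  · have : P v = 0 := Subtype.ext hv
    simp [this]
  · let R : Submodule ℝ H := ((S q).comp (T q)).range
    have hRD : R ≤ (S q).range := by
      rintro _ ⟨w, rfl⟩
      exact ⟨T q w, rfl⟩
    have hinj : Function.Injective ((S q).comp (T q)) := fun a b hab => by
      rw [← hq' a, ← hq' b]
      exact congrArg P hab
    have hfr : Module.finrank ℝ R = Module.finrank ℝ (S p).range :=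
      LinearMap.finrank_range_of_inj hinj
    have hRe : R = (S q).range := Submodule.eq_of_le_of_finrank_le hRD (by rw [hfr]; exact hr)
    have hc : S q c ∈ R := by
      rw [hRe]
      exact ⟨c, rfl⟩
    obtain ⟨w, hw⟩ := hc
    have hw' : S q (T q w) = S q c := hw
    simp only [ContinuousLinearMap.comp_apply]
    rw [← hw', hq']
  · have hle : (S q).range ≤ ((S q).comp (T q)).range := by
      rintro _ ⟨c, rfl⟩
      exact ⟨P (S q c), h c⟩
    exact (Submodule.finrank_mono hle).trans (LinearMap.finrank_range_le _)

/-- The rank of a family of linear maps does not increase along the integral curves of a field `V`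
such that the bracket of `V` with the sections of the images are sections of the images. -/
theorem eventually_finrank_range_le {S : H → (Fin k → ℝ) →L[ℝ] H} {p : H}
    (hS : ∀ᶠ q in 𝓝 p, ContDiffAt ℝ ∞ S q) {V : H → H} (hV : ContDiffAt ℝ ∞ V p)
    (hbr : ∀ a : H → (Fin k → ℝ), (∀ᶠ q in 𝓝 p, ContDiffAt ℝ ∞ a q) →
      ∃ c : H → (Fin k → ℝ), ContinuousAt c p ∧
        ∀ᶠ q in 𝓝 p, VectorField.lieBracket ℝ V (fun q => S q (a q)) q = S q (c q))
    {γ : ℝ → H} (h0 : γ 0 = p) (hγ : ∀ᶠ t in 𝓝 (0 : ℝ), HasDerivAt γ (V (γ t)) t) :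
    ∀ᶠ t in 𝓝 (0 : ℝ), Module.finrank ℝ (S (γ t)).range ≤ Module.finrank ℝ (S p).range := by
  obtain ⟨L, P, hL, hLP⟩ := exists_adapted_lift hS
  let e : Fin k → Fin k → ℝ := fun j => Pi.single j 1
  -- Chosen so that `S q (a j q)` is the `j`-th column of the defect `A`: the columns are sections
  -- of the images, and `hbr` applies to them.
  let a : Fin k → H → (Fin k → ℝ) := fun j q => e j - L q (S q (e j))
  have ha : ∀ j, ∀ᶠ q in 𝓝 p, ContDiffAt ℝ ∞ (a j) q := by
    intro j
    filter_upwards [hS, hL] with q h1 h2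
    exact contDiffAt_const.sub (h2.clm_apply (h1.clm_apply contDiffAt_const))
  let A : H → (Fin k → ℝ) →L[ℝ] H := fun q => S q - ((S q).comp (L q)).comp (S q)
  have hA : ∀ q c, A q c = S q c - S q (L q (S q c)) := fun q c => rfl
  have hAa : ∀ j q, S q (a j q) = A q (e j) := fun j q => by simp [a, hA]
  choose c hc hbc using fun j => hbr (a j) (ha j)
  choose C₁ hC₁ hbC₁ using fun j => exists_eventually_norm_le (hc j)
  obtain ⟨C₂, hC₂, hbC₂⟩ := exists_eventually_norm_le
    (hS.self_of_nhds.clm_comp hL.self_of_nhds).continuousAt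
  obtain ⟨C₃, hC₃, hbC₃⟩ := exists_eventually_norm_le
    (hV.fderiv_right (m := ∞) (by simp)).continuousAt
  have hAd : ∀ᶠ q in 𝓝 p, ContDiffAt ℝ ∞ A q := by
    filter_upwards [hS, hL] with q h1 h2 using h1.sub ((h1.clm_comp h2).clm_comp h1)
  have hPA : ∀ᶠ q in 𝓝 p, ∀ j, P (A q (e j)) = 0 := by
    filter_upwards [hLP] with q hq j
    rw [hA, map_sub, hq.1, sub_self]
  -- the derivative of the frame of the defect along `V`
  have key : ∀ᶠ q in 𝓝 p, ‖fun j => fderiv ℝ (fun q => A q (e j)) q (V q)‖ ≤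
      (k * (∑ j, C₁ j) + (1 + C₂) * C₃) * ‖fun j => A q (e j)‖ := by
    filter_upwards [Filter.eventually_all.2 hbc, Filter.eventually_all.2 hbC₁, hbC₂, hbC₃, hAd, hLP,
      hPA.eventually_nhds] with q h1 h2 h3 h4 h5 h6 h7
    refine (pi_norm_le_iff_of_nonneg (mul_nonneg (add_nonneg (mul_nonneg (Nat.cast_nonneg _)
      (Finset.sum_nonneg fun j _ => hC₁ j)) (by positivity)) (norm_nonneg _))).2 fun j => ?_
    have hbr := h1 j
    simp only [hAa] at hbr
    rw [VectorField.lieBracket] at hbr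
    set D := fderiv ℝ (fun q => A q (e j)) q (V q) with hD
    have hPD : P D = 0 := by
      have hd : DifferentiableAt ℝ (fun q => A q (e j)) q :=
        (h5.clm_apply contDiffAt_const).differentiableAt (by simp)
      have h8 : fderiv ℝ (fun q => P (A q (e j))) q = P.comp (fderiv ℝ (fun q => A q (e j)) q) :=
        (P.hasFDerivAt.comp q hd.hasFDerivAt).fderiv
      have h9 : fderiv ℝ (fun q => P (A q (e j))) q = 0 := by
        have : (fun q => P (A q (e j))) =ᶠ[𝓝 q] fun _ => 0 := h7.mono fun q hq => hq j
        rw [this.fderiv_eq]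
        simp
      rw [h9] at h8
      exact (congrArg (fun L => L (V q)) h8).symm
    -- `P` kills the columns of `A` near `q`, hence also their derivatives, and `L q` vanishes on
    -- the kernel of `P`.
    have hLD : L q D = 0 := h6.2.1 _ hPD
    -- The bracket gives D = S c + DV(A e). Applying 1 - SL, which fixes `D`, turns S c into A c, so
    -- that both terms are controlled by the columns of `A`.
    have hDV : D = A q (c j q) + (fderiv ℝ V q (A q (e j)) -
        S q (L q (fderiv ℝ V q (A q (e j))))) := by
      have h8 : D = S q (c j q) + fderiv ℝ V q (A q (e j)) := by
        rw [← hbr]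
        abel
      have h9 : S q (L q (S q (c j q))) = - S q (L q (fderiv ℝ V q (A q (e j)))) := by
        have : L q (S q (c j q)) = - L q (fderiv ℝ V q (A q (e j))) := by
          rw [← hbr, map_sub, hLD, zero_sub]
        rw [this, map_neg]
      rw [hA q (c j q), h9, h8]
      abel
    rw [hDV]
    set b := ‖fun j => A q (e j)‖ with hb
    have hb0 : 0 ≤ b := norm_nonneg _
    have hw : ‖fderiv ℝ V q (A q (e j))‖ ≤ C₃ * b :=
      (ContinuousLinearMap.le_opNorm _ _).trans
        (mul_le_mul h4 (norm_le_pi_norm (fun j => A q (e j)) j) (norm_nonneg _) hC₃)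
    have hSw : ‖S q (L q (fderiv ℝ V q (A q (e j))))‖ ≤ C₂ * (C₃ * b) :=
      (ContinuousLinearMap.le_opNorm ((S q).comp (L q)) _).trans
        (mul_le_mul h3 hw (norm_nonneg _) hC₂)
    have hAc : ‖A q (c j q)‖ ≤ k * (∑ j, C₁ j) * b := by
      refine (norm_apply_le_card_mul _ _).trans ?_
      refine mul_le_mul_of_nonneg_right (mul_le_mul_of_nonneg_left ?_ (Nat.cast_nonneg _)) hb0
      exact (h2 j).trans (Finset.single_le_sum (fun j _ => hC₁ j) (Finset.mem_univ j))
    calc _ ≤ ‖A q (c j q)‖ + (‖fderiv ℝ V q (A q (e j))‖ +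
          ‖S q (L q (fderiv ℝ V q (A q (e j))))‖) :=
          (norm_add_le _ _).trans (add_le_add_right (norm_sub_le _ _) _)
      _ ≤ k * (∑ j, C₁ j) * b + (C₃ * b + C₂ * (C₃ * b)) := by gcongr
      _ = _ := by ring
  have hγc : ContinuousAt γ 0 := hγ.self_of_nhds.continuousAt
  have hγt : Filter.Tendsto γ (𝓝 0) (𝓝 p) := by
    rw [← h0]
    exact hγc
  have hzero : ∀ᶠ t in 𝓝 (0 : ℝ), (fun j => A (γ t) (e j)) = 0 := by
    refine eventually_eq_zero_of_norm_deriv_le (b := fun t j => A (γ t) (e j))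
      (b' := fun t j => fderiv ℝ (fun q => A q (e j)) (γ t) (V (γ t))) ?_ ?_
      (C := k * (∑ j, C₁ j) + (1 + C₂) * C₃)
    · funext j
      rw [h0, hA, hLP.self_of_nhds.2.2.1 le_rfl, sub_self]
      rfl
    · filter_upwards [hγ, hγt.eventually key, hγt.eventually hAd] with t h1 h2 h3
      refine ⟨hasDerivAt_pi.2 fun j => ?_, h2⟩
      have hd : DifferentiableAt ℝ (fun q => A q (e j)) (γ t) :=
        (h3.clm_apply contDiffAt_const).differentiableAt (by simp)
      exact hd.hasFDerivAt.comp_hasDerivAt t h1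
  filter_upwards [hzero, hγt.eventually hLP] with t h1 h2
  refine h2.2.2.2 fun v => ?_
  have h3 := norm_apply_le_card_mul (A (γ t)) v
  have h4 : (fun j => A (γ t) (Pi.single j 1)) = 0 := h1
  rw [h4, norm_zero, mul_zero, norm_le_zero_iff, hA, sub_eq_zero] at h3
  exact h3.symm

end Adapted

/-! ### Integral curves and derivatives along them. -/

section CurveDerivative

variable {m : ℕ} {M : Type*} [TopologicalSpace M] [ChartedSpace (Model m) M]

theorem hasDerivAt_comp_curve {γ : ℝ → M} {t : ℝ} {v : TangentSpace (𝓡 m) (γ t)} {f : M → ℝ}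
    (h : HasMFDerivAt 𝓘(ℝ, ℝ) (𝓡 m) γ t ((1 : ℝ →L[ℝ] ℝ).smulRight v))
    (hf : ContMDiff (𝓡 m) 𝓘(ℝ, ℝ) ∞ f) :
    HasDerivAt (fun s => f (γ s)) (dFun f (γ t) v) t := by
  have h1 : HasMFDerivAt (𝓡 m) 𝓘(ℝ, ℝ) f (γ t) (dFun f (γ t)) :=
    ((hf (γ t)).mdifferentiableAt (by simp)).hasMFDerivAt
  have h2 : HasMFDerivAt 𝓘(ℝ, ℝ) 𝓘(ℝ, ℝ) (fun s => f (γ s)) t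
      (ContinuousLinearMap.toSpanSingleton ℝ (dFun f (γ t) v) : ℝ →L[ℝ] ℝ) :=
    (HasMFDerivAt.comp t h1 h).congr_mfderiv
      (ContinuousLinearMap.ext fun a => (dFun f (γ t)).map_smul a v)
  have h3 : HasFDerivAt (fun s => f (γ s))
      (ContinuousLinearMap.toSpanSingleton ℝ (dFun f (γ t) v) : ℝ →L[ℝ] ℝ) t :=
    hasMFDerivAt_iff_hasFDerivAt.1 h2
  exact hasDerivAt_iff_hasFDerivAt.2 h3

end CurveDerivative

section Curves

variable {m : ℕ} {M : Type*} [TopologicalSpace M] [ChartedSpace (Model m) M]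
  [IsManifold (𝓡 m) ∞ M]

theorem hasDerivAt_extChartAt_comp {γ : ℝ → M} {t : ℝ} {x : M} {v : TangentSpace (𝓡 m) (γ t)}
    (h : HasMFDerivAt 𝓘(ℝ, ℝ) (𝓡 m) γ t ((1 : ℝ →L[ℝ] ℝ).smulRight v))
    (hx : γ t ∈ (chartAt (Model m) x).source) :
    HasDerivAt (fun s => extChartAt (𝓡 m) x (γ s)) (toModel x (γ t) v) t := by
  have h1 : HasMFDerivAt (𝓡 m) 𝓘(ℝ, Model m) (extChartAt (𝓡 m) x) (γ t) (toModel x (γ t)) := by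
    rw [toModel_eq_mfderiv hx]
    exact (mdifferentiableAt_extChartAt (I := 𝓡 m) hx).hasMFDerivAt
  have h2 : HasMFDerivAt 𝓘(ℝ, ℝ) 𝓘(ℝ, Model m) (fun s => extChartAt (𝓡 m) x (γ s)) t
      (ContinuousLinearMap.toSpanSingleton ℝ (toModel x (γ t) v) : ℝ →L[ℝ] Model m) :=
    (HasMFDerivAt.comp t h1 h).congr_mfderiv
      (ContinuousLinearMap.ext fun a => (toModel x (γ t)).map_smul a v)
  have h3 : HasFDerivAt (fun s => extChartAt (𝓡 m) x (γ s))
      (ContinuousLinearMap.toSpanSingleton ℝ (toModel x (γ t) v) : ℝ →L[ℝ] Model m) t :=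
    hasMFDerivAt_iff_hasFDerivAt.1 h2
  exact hasDerivAt_iff_hasFDerivAt.2 h3

theorem exists_integralCurve {X : VField m M} (hX : SmoothVFieldOn X Set.univ) (x : M) :
    ∃ γ : ℝ → M, γ 0 = x ∧ IsMIntegralCurveAt (I := 𝓡 m) γ X 0 :=
  exists_isMIntegralCurveAt_of_contMDiffAt_boundaryless 0
    ((hX.contMDiffAt' x).of_le (by simp))

/-- The representative in a chart of an integral curve. -/
theorem IsMIntegralCurveAt.eventually_hasDerivAt_chart {X : VField m M} {γ : ℝ → M} {x : M}
    (h0 : γ 0 = x) (hγ : IsMIntegralCurveAt (I := 𝓡 m) γ X 0) :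
    ∀ᶠ t in 𝓝 (0 : ℝ), γ t ∈ (chartAt (Model m) x).source ∧
      HasDerivAt (fun s => extChartAt (𝓡 m) x (γ s))
        (chartField X x (extChartAt (𝓡 m) x (γ t))) t := by
  have hs : ∀ᶠ t in 𝓝 (0 : ℝ), γ t ∈ (chartAt (Model m) x).source := by
    refine hγ.continuousAt.eventually ?_
    rw [h0]
    exact (chartAt (Model m) x).open_source.mem_nhds (mem_chart_source (Model m) x)
  filter_upwards [hγ, hs] with t ht hst
  refine ⟨hst, ?_⟩
  have hst' : γ t ∈ (extChartAt (𝓡 m) x).source := by rwa [extChartAt_source]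
  rw [chartField_eq X ((extChartAt (𝓡 m) x).map_source hst'), (extChartAt (𝓡 m) x).left_inv hst']
  exact hasDerivAt_extChartAt_comp ht hst

/-- The bracket of `X` with a field which vanishes along the integral curve of `X`. -/
theorem mlieBracket_eq_zero_of_curve {X W : VField m M} (hX : SmoothVFieldOn X Set.univ)
    (hW : SmoothVFieldOn W Set.univ) {γ : ℝ → M} {x : M} (h0 : γ 0 = x)
    (hγ : IsMIntegralCurveAt (I := 𝓡 m) γ X 0) (hWγ : ∀ᶠ t in 𝓝 (0 : ℝ), W (γ t) = 0) :
    VectorField.mlieBracket (𝓡 m) X W x = 0 := by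
  have hs := mem_chart_source (Model m) x
  have hc := IsMIntegralCurveAt.eventually_hasDerivAt_chart h0 hγ
  have hWx : chartField W x (extChartAt (𝓡 m) x x) = 0 := by
    rw [chartField_self, ← h0, hWγ.self_of_nhds, map_zero]
  -- In [X, W] = DW·X - DX·W the second term vanishes with W at `x`; the first is the derivative of
  -- W along the curve.
  have hd : fderiv ℝ (chartField W x) (extChartAt (𝓡 m) x x)
      (chartField X x (extChartAt (𝓡 m) x x)) = 0 := by
    have h1 := ((hW.contDiffAt x).differentiableAt (by simp)).hasFDerivAt
    have h2 := hc.self_of_nhds.2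
    rw [h0] at h2
    have h3 : HasDerivAt (fun t => chartField W x (extChartAt (𝓡 m) x (γ t)))
        (fderiv ℝ (chartField W x) (extChartAt (𝓡 m) x x)
          (chartField X x (extChartAt (𝓡 m) x x))) 0 := by
      refine HasFDerivAt.comp_hasDerivAt (0 : ℝ) ?_ h2
      rw [h0]
      exact h1
    have h4 : (fun t => chartField W x (extChartAt (𝓡 m) x (γ t))) =ᶠ[𝓝 0] fun _ => 0 := by
      filter_upwards [hc, hWγ] with t ht hWt
      have hst' : γ t ∈ (extChartAt (𝓡 m) x).source := by
        rw [extChartAt_source]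
        exact ht.1
      rw [chartField_eq W ((extChartAt (𝓡 m) x).map_source hst'),
        (extChartAt (𝓡 m) x).left_inv hst', hWt, map_zero]
    exact h3.unique ((hasDerivAt_const (0 : ℝ) (0 : Model m)).congr_of_eventuallyEq h4)
  have h5 := chartField_mlieBracket hX hW (mem_extChartAt_target (I := 𝓡 m) x)
  rw [VectorField.lieBracket, hd, hWx, map_zero, sub_zero, chartField_self] at h5
  rw [← fromModel_toModel hs (VectorField.mlieBracket (𝓡 m) X W x), h5, map_zero]

end Curves

/-! ### Frames of E and lifts of the fields of 𝓔. -/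

namespace BigIsotropic

variable {m k : ℕ} {M : Type*} [TopologicalSpace M] [ChartedSpace (Model m) M]
  [IsManifold (𝓡 m) ∞ M] (E : BigIsotropic m k M)

/-- A smooth frame of `E` in the preferred chart at `x`. -/
theorem exists_chart_frame (x : M) :
    ∃ S : Model m → (Fin k → ℝ) →L[ℝ] BigModel m,
      (∀ᶠ p in 𝓝 (extChartAt (𝓡 m) x x), ContDiffAt ℝ ∞ S p) ∧
      ∀ᶠ p in 𝓝 (extChartAt (𝓡 m) x x), Function.Injective (S p) ∧
        ∀ u : BigModel m, fromBigModel x ((extChartAt (𝓡 m) x).symm p) u ∈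
          E.fiber ((extChartAt (𝓡 m) x).symm p) ↔ ∃ c, S p c = u := by
  obtain ⟨U, hU, hxU, s, hs, hsU⟩ := E.exists_local_frame x
  let S : Model m → (Fin k → ℝ) →L[ℝ] BigModel m := fun p =>
    ∑ i, (ContinuousLinearMap.proj (R := ℝ) (φ := fun _ : Fin k => ℝ) i).smulRight
      (chartBig (s i) x p)
  have hS : ∀ p c, S p c = ∑ i, c i • chartBig (s i) x p := by
    intro p c
    simp [S]
  refine ⟨S, ?_, ?_⟩
  · filter_upwards [Filter.eventually_all.2 fun i => (hs i).eventually_contDiffAt hU hxU] with p hp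
    exact ContDiffAt.sum fun i _ => contDiffAt_const.smulRight (hp i)
  · filter_upwards [eventually_mem_target x, eventually_symm_mem (hU.mem_nhds hxU)] with p hp hpU
    have hsrc := mem_chartSource_of_mem_target hp
    have hfS : ∀ c, fromBigModel x ((extChartAt (𝓡 m) x).symm p) (S p c) =
        ∑ i, c i • s i ((extChartAt (𝓡 m) x).symm p) := by
      intro c
      simp only [hS, map_sum, map_smul, fromBigModel_chartBig _ hp]
    refine ⟨fun c d hcd => ?_, fun u => ?_⟩
    · have h := congrArg (fromBigModel x ((extChartAt (𝓡 m) x).symm p)) hcd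
      rw [hfS, hfS] at h
      exact (linearIndependent_iff_injective_fintypeLinearCombination.1 (hsU _ hpU).1) (by
        rw [Fintype.linearCombination_apply, Fintype.linearCombination_apply]
        exact h)
    · rw [← (hsU _ hpU).2, Submodule.mem_span_range_iff_exists_fun]
      refine exists_congr fun c => ?_
      rw [← hfS]
      refine ⟨fun h => ?_, fun h => by rw [h]⟩
      rw [← toBigModel_fromBigModel hsrc (S p c), h, toBigModel_fromBigModel hsrc]

end BigIsotropic

namespace BigIsotropic

section Lifts

variable {m k : ℕ} {M : Type*} [TopologicalSpace M] [ChartedSpace (Model m) M]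
  [IsManifold (𝓡 m) ∞ M] (E : BigIsotropic m k M)

theorem mem_charDist_iff {x : M} {v : TangentSpace (𝓡 m) x} :
    v ∈ E.charDist x ↔ ∃ α : Cotangent m M x, ((v, α) : BigTangent m M x) ∈ E.fiber x := by
  constructor
  · rintro ⟨u, hu, rfl⟩
    exact ⟨u.2, hu⟩
  · rintro ⟨α, h⟩
    exact ⟨_, h, rfl⟩

theorem mem_charDist'_iff {x : M} {v : TangentSpace (𝓡 m) x} :
    v ∈ E.charDist' x ↔ ∃ α : Cotangent m M x, ((v, α) : BigTangent m M x) ∈ E.orthFiber x := by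
  constructor
  · rintro ⟨u, hu, rfl⟩
    exact ⟨u.2, hu⟩
  · rintro ⟨α, h⟩
    exact ⟨_, h, rfl⟩

variable {E}

theorem mem_charDist_iff_range {x y : M} (hy : y ∈ (chartAt (Model m) x).source)
    {S : (Fin k → ℝ) →L[ℝ] BigModel m}
    (hS : ∀ u : BigModel m, fromBigModel x y u ∈ E.fiber y ↔ ∃ c, S c = u)
    (v : TangentSpace (𝓡 m) y) : v ∈ E.charDist y ↔ ∃ c, (S c).1 = toModel x y v := by
  rw [mem_charDist_iff]
  constructor
  · rintro ⟨α, h⟩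
    rw [← fromBigModel_toBigModel hy ((v, α) : BigTangent m M y), hS] at h
    obtain ⟨c, hc⟩ := h
    exact ⟨c, congrArg Prod.fst hc⟩
  · rintro ⟨c, hc⟩
    have h := (hS (S c)).2 ⟨c, rfl⟩
    refine ⟨(fromBigModel x y (S c)).2, ?_⟩
    convert h using 1
    refine Prod.ext ?_ rfl
    change v = fromModel x y (S c).1
    rw [hc, fromModel_toModel hy]

theorem finrank_charDist_eq {x y : M} (hy : y ∈ (chartAt (Model m) x).source)
    {S : (Fin k → ℝ) →L[ℝ] BigModel m}
    (hS : ∀ u : BigModel m, fromBigModel x y u ∈ E.fiber y ↔ ∃ c, S c = u) :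
    Module.finrank ℝ (E.charDist y) =
      Module.finrank ℝ ((ContinuousLinearMap.fst ℝ (Model m) (Model m →L[ℝ] ℝ)).comp S).range := by
  let e : TangentSpace (𝓡 m) y ≃ₗ[ℝ] Model m :=
    LinearEquiv.ofLinearMap (toModel x y).toLinearMap (fromModel x y).toLinearMap
      (LinearMap.ext fun v => toModel_fromModel hy v)
      (LinearMap.ext fun v => fromModel_toModel hy v)
  have h : (E.charDist y).map (e : TangentSpace (𝓡 m) y →ₗ[ℝ] Model m) =
      ((ContinuousLinearMap.fst ℝ (Model m) (Model m →L[ℝ] ℝ)).comp S).range := by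
    ext w
    constructor
    · rintro ⟨v, hv, rfl⟩
      exact (mem_charDist_iff_range hy hS v).1 hv
    · rintro ⟨c, rfl⟩
      refine ⟨fromModel x y (S c).1, (mem_charDist_iff_range hy hS _).2 ⟨c, ?_⟩, ?_⟩
      · rw [toModel_fromModel hy]
      · exact toModel_fromModel hy _
  rw [← h]
  exact (LinearEquiv.finrank_map_eq e _).symm

variable (E)

/-- A vector field of `𝓔` has a lift to a section of `E`, near `x` and at the points where the
dimension of `𝓔` does not exceed its value at `x`. -/
theorem exists_lift [T2Space M] {X : VField m M} (hX : IsSmoothFieldIn X E.charDist) (x : M) :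
    ∃ σ : BigField m M, E.IsSection σ ∧
      (∀ᶠ y in 𝓝 x, Module.finrank ℝ (E.charDist y) ≤ Module.finrank ℝ (E.charDist x) →
        (σ y).1 = X y) ∧ (X x = 0 → σ x = 0) := by
  obtain ⟨S, hS, hSE⟩ := E.exists_chart_frame x
  have hS1 : ∀ᶠ p in 𝓝 (extChartAt (𝓡 m) x x), ContDiffAt ℝ ∞
      (fun p => (ContinuousLinearMap.fst ℝ (Model m) (Model m →L[ℝ] ℝ)).comp (S p)) p :=
    hS.mono fun p hp => contDiffAt_const.clm_comp hp
  obtain ⟨L, P, hL, hLP⟩ := exists_adapted_lift hS1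
  obtain ⟨σ, hσs, hσE, hσ⟩ := exists_global_extension E.fiber x
    (f := fun p => S p (L p (chartField X x p)))
    (by
      filter_upwards [hS, hL, hX.1.eventually_contDiffAt isOpen_univ (Set.mem_univ x)]
        with p h1 h2 h3 using h1.clm_apply (h2.clm_apply h3))
    (hSE.mono fun p hp => (hp.2 _).2 ⟨_, rfl⟩)
  refine ⟨σ, ⟨hσs, hσE⟩, ?_, fun h0 => ?_⟩
  · have key : ∀ᶠ p in 𝓝 (extChartAt (𝓡 m) x x),
        Module.finrank ℝ (E.charDist ((extChartAt (𝓡 m) x).symm p)) ≤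
          Module.finrank ℝ (E.charDist x) →
        (σ ((extChartAt (𝓡 m) x).symm p)).1 = X ((extChartAt (𝓡 m) x).symm p) := by
      filter_upwards [hSE, hLP, hσ, eventually_mem_target x] with p h1 h2 h3 hp hr
      have hsrc := mem_chartSource_of_mem_target hp
      have h4 := hSE.self_of_nhds.2
      rw [extChartAt_to_inv] at h4
      rw [finrank_charDist_eq hsrc h1.2, finrank_charDist_eq (mem_chart_source _ x) h4] at hr
      obtain ⟨c, hc⟩ := (mem_charDist_iff_range hsrc h1.2 _).1
        (hX.2 ((extChartAt (𝓡 m) x).symm p))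
      have h5 := h2.2.2.1 hr c
      have h6 : (chartBig σ x p).1 = chartField X x p := by
        rw [h3, chartField_eq X hp, ← hc]
        exact h5
      rw [chartBig_eq σ hp, chartField_eq X hp] at h6
      rw [← fromModel_toModel hsrc (X ((extChartAt (𝓡 m) x).symm p)), ← h6]
      exact (fromModel_toModel hsrc _).symm
    filter_upwards [eventually_chart key, extChartAt_source_mem_nhds (I := 𝓡 m) x] with y hy hys
    rwa [(extChartAt (𝓡 m) x).left_inv hys] at hy
  · have h1 := hσ.self_of_nhds
    simp only [chartField_self, h0, map_zero] at h1
    rw [chartBig_self] at h1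
    rw [← fromBigModel_toBigModel (mem_chart_source (Model m) x) (σ x), h1, map_zero]

theorem exists_section_through [T2Space M] {x : M} {u : BigTangent m M x} (hu : u ∈ E.fiber x) :
    ∃ σ : BigField m M, E.IsSection σ ∧ σ x = u := by
  obtain ⟨S, hS, hSE⟩ := E.exists_chart_frame x
  have hs := mem_chart_source (Model m) x
  have h4 := hSE.self_of_nhds.2
  rw [extChartAt_to_inv] at h4
  rw [← fromBigModel_toBigModel hs u, h4] at hu
  obtain ⟨c, hc⟩ := hu
  obtain ⟨σ, hσs, hσE, hσ⟩ := exists_global_extension E.fiber x (f := fun p => S p c)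
    (hS.mono fun p hp => hp.clm_apply contDiffAt_const)
    (hSE.mono fun p hp => (hp.2 _).2 ⟨_, rfl⟩)
  refine ⟨σ, ⟨hσs, hσE⟩, ?_⟩
  have h1 := hσ.self_of_nhds
  rw [chartBig_self, hc] at h1
  rw [← fromBigModel_toBigModel hs (σ x), h1, fromBigModel_toBigModel hs]

/-- The dimension of `𝓔` does not increase along the integral curves of the projections of the
sections of an integrable `E`. -/
theorem eventually_finrank_le_of_curve [T2Space M] (hE : E.Integrable) {σ : BigField m M}
    (hσ : E.IsSection σ) {γ : ℝ → M} {x : M} (h0 : γ 0 = x)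
    (hγ : IsMIntegralCurveAt (I := 𝓡 m) γ (fun y => (σ y).1) 0) :
    ∀ᶠ t in 𝓝 (0 : ℝ), Module.finrank ℝ (E.charDist (γ t)) ≤
      Module.finrank ℝ (E.charDist x) := by
  obtain ⟨S, hS, hSE⟩ := E.exists_chart_frame x
  have hS1 : ∀ᶠ p in 𝓝 (extChartAt (𝓡 m) x x), ContDiffAt ℝ ∞
      (fun p => (ContinuousLinearMap.fst ℝ (Model m) (Model m →L[ℝ] ℝ)).comp (S p)) p :=
    hS.mono fun p hp => contDiffAt_const.clm_comp hp
  -- `T` recovers the coefficients of a section of E in the frame `S`. Injectivity holds for the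
  -- frame of E, not for its projection to TM.
  obtain ⟨T, hT, hTS⟩ := exists_smooth_leftInverse hS hSE.self_of_nhds.1
  have hc := IsMIntegralCurveAt.eventually_hasDerivAt_chart h0 hγ
  have hmain := eventually_finrank_range_le hS1 (hσ.1.1.contDiffAt x) ?_
    (γ := fun t => extChartAt (𝓡 m) x (γ t)) (by simp only [h0]) (hc.mono fun t ht => ht.2)
  · have hSEγ : ∀ᶠ t in 𝓝 (0 : ℝ), ∀ u : BigModel m,
        fromBigModel x ((extChartAt (𝓡 m) x).symm (extChartAt (𝓡 m) x (γ t))) u ∈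
          E.fiber ((extChartAt (𝓡 m) x).symm (extChartAt (𝓡 m) x (γ t))) ↔
            ∃ c, S (extChartAt (𝓡 m) x (γ t)) c = u := by
      have hγx : Filter.Tendsto γ (𝓝 0) (𝓝 x) := by
        have := hγ.continuousAt
        rwa [ContinuousAt, h0] at this
      exact hγx.eventually (eventually_chart (hSE.mono fun p hp => hp.2))
    filter_upwards [hmain, hc, hSEγ] with t h1 h2 h3
    have hst' : γ t ∈ (extChartAt (𝓡 m) x).source := by
      rw [extChartAt_source]
      exact h2.1
    rw [(extChartAt (𝓡 m) x).left_inv hst'] at h3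
    have h4 := hSE.self_of_nhds.2
    rw [extChartAt_to_inv] at h4
    rwa [finrank_charDist_eq h2.1 h3, finrank_charDist_eq (mem_chart_source _ x) h4]
  · intro a ha
    -- Integrability concerns global sections, so the local section `S a` is extended; the
    -- coefficients of the Courant bracket of σ and τ serve as `c`.
    obtain ⟨τ, hτs, hτE, hτ⟩ := exists_global_extension E.fiber x (f := fun p => S p (a p))
      (by filter_upwards [hS, ha] with p h1 h2 using h1.clm_apply h2)
      (hSE.mono fun p hp => (hp.2 _).2 ⟨_, rfl⟩)
    have hb := hE σ τ hσ ⟨hτs, hτE⟩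
    have hbs := hb.1.eventually_contDiffAt isOpen_univ (Set.mem_univ x)
    refine ⟨fun p => T p (chartBig (courantBracket σ τ) x p),
      (hT.self_of_nhds.clm_apply hbs.self_of_nhds).continuousAt, ?_⟩
    filter_upwards [hSE, hTS, hτ.eventually_nhds, eventually_mem_target x] with p h1 h2 h3 hp
    have h4 := hb.2 ((extChartAt (𝓡 m) x).symm p)
    rw [← fromBigModel_chartBig (courantBracket σ τ) hp, h1.2] at h4
    obtain ⟨c, hc⟩ := h4
    have h5 := chartField_mlieBracket hσ.1.1 hτs.1 hp
    have h6 : chartField (fun y => (τ y).1) x =ᶠ[𝓝 p] fun q =>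
        ((ContinuousLinearMap.fst ℝ (Model m) (Model m →L[ℝ] ℝ)).comp (S q)) (a q) := by
      filter_upwards [h3] with q hq using congrArg Prod.fst hq
    rw [← (Filter.EventuallyEq.refl _ _).lieBracket_vectorField_eq h6, ← h5, ← hc, h2]
    exact congrArg Prod.fst hc.symm

end Lifts

end BigIsotropic

/-! ### The neutral metric and the orthogonal bundle E'. -/

section Metric

variable {m : ℕ} {M : Type*} [TopologicalSpace M] [ChartedSpace (Model m) M]

theorem neutralMetric_apply (x : M) (u v : BigTangent m M x) :
    neutralMetric x u v = (u.2 v.1 + v.2 u.1) / 2 := rfl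

theorem neutralMetric_isRefl (x : M) : (neutralMetric (m := m) x).IsRefl := fun u v h => by
  rw [neutralMetric_apply] at h ⊢
  rw [add_comm]
  exact h

theorem cotangent_separates {x : M} {v : TangentSpace (𝓡 m) x}
    (h : ∀ α : Cotangent m M x, α v = 0) : v = 0 :=
  SeparatingDual.eq_zero_of_forall_dual_eq_zero (R := ℝ) (V := Model m) (x := v) h

theorem neutralMetric_nondegenerate (x : M) : (neutralMetric (m := m) x).Nondegenerate := by
  have h : ∀ u : BigTangent m M x, (∀ v, neutralMetric x u v = 0) → u = 0 := by
    intro u hu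
    refine Prod.ext (cotangent_separates fun α => ?_) (ContinuousLinearMap.ext fun v => ?_)
    · have := hu (0, α)
      rw [neutralMetric_apply] at this
      simpa using this
    · have := hu (v, 0)
      rw [neutralMetric_apply] at this
      simpa using this
  refine ⟨fun u hu => h u hu, fun u hu => h u fun v => ?_⟩
  exact neutralMetric_isRefl x v u (hu v)

instance finiteDimensional_bigTangent (x : M) : FiniteDimensional ℝ (BigTangent m M x) :=
  inferInstanceAs (FiniteDimensional ℝ (Model m × (Model m →L[ℝ] ℝ)))

theorem finrank_bigTangent (x : M) : Module.finrank ℝ (BigTangent m M x) = m + m := by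
  have h1 : Module.finrank ℝ (Model m →L[ℝ] ℝ) = m := by
    rw [← (LinearMap.toContinuousLinearMap (𝕜 := ℝ) (E := Model m) (F' := ℝ)).finrank_eq]
    simp
  have h2 : Module.finrank ℝ (Model m × (Model m →L[ℝ] ℝ)) = m + m := by
    rw [Module.finrank_prod, h1]
    simp
  exact h2

end Metric

section LinearAlgebra

theorem exists_dual_comp_eq {A B : Type*} [AddCommGroup A] [Module ℝ A] [AddCommGroup B]
    [Module ℝ B] (f : A →ₗ[ℝ] B) (ψ : Module.Dual ℝ A) (h : ∀ a, f a = 0 → ψ a = 0) :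
    ∃ φ : Module.Dual ℝ B, ∀ a, φ (f a) = ψ a := by
  have hψ : ψ ∈ f.dualMap.range := by
    rw [LinearMap.range_dualMap_eq_dualAnnihilator_ker, Submodule.mem_dualAnnihilator]
    exact h
  obtain ⟨φ, hφ⟩ := hψ
  exact ⟨φ, LinearMap.congr_fun hφ⟩

/-- The functional w ↦ -w.2(v) on `W` vanishes on the kernel of the projection to `V`, hence factors
through that projection; the factor is β. -/
theorem exists_dual_of_annihilates {V : Type*} [NormedAddCommGroup V] [NormedSpace ℝ V]
    [FiniteDimensional ℝ V] (W : Submodule ℝ (V × (V →L[ℝ] ℝ))) (v : V)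
    (h : ∀ α : V →L[ℝ] ℝ, ((0, α) : V × (V →L[ℝ] ℝ)) ∈ W → α v = 0) :
    ∃ β : V →L[ℝ] ℝ, ∀ w ∈ W, w.2 v + β w.1 = 0 := by
  let pr : W →ₗ[ℝ] V := (LinearMap.fst ℝ V (V →L[ℝ] ℝ)).comp W.subtype
  let ψ : Module.Dual ℝ W :=
    -((ContinuousLinearMap.apply ℝ ℝ v).toLinearMap.comp
      ((LinearMap.snd ℝ V (V →L[ℝ] ℝ)).comp W.subtype))
  obtain ⟨φ, hφ⟩ := exists_dual_comp_eq (A := W) (B := V) pr ψ fun w hw => by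
    obtain ⟨⟨w, α⟩, hwW⟩ := w
    have hw0 : w = 0 := hw
    subst hw0
    change - α v = 0
    rw [h α hwW, neg_zero]
  refine ⟨LinearMap.toContinuousLinearMap φ, fun w hw => ?_⟩
  have h1 : φ w.1 = - w.2 v := hφ ⟨w, hw⟩
  change w.2 v + φ w.1 = 0
  rw [h1, add_neg_cancel]

end LinearAlgebra

namespace BigIsotropic

section Orthogonal

variable {m k : ℕ} {M : Type*} [TopologicalSpace M] [ChartedSpace (Model m) M]
  [IsManifold (𝓡 m) ∞ M] (E : BigIsotropic m k M)

theorem mem_orthFiber_iff {x : M} {u : BigTangent m M x} :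
    u ∈ E.orthFiber x ↔ ∀ w ∈ E.fiber x, w.2 u.1 + u.2 w.1 = 0 := by
  rw [orthFiber, LinearMap.BilinForm.mem_orthogonal_iff]
  refine forall₂_congr fun w _ => ?_
  change (w.2 u.1 + u.2 w.1) / 2 = 0 ↔ _
  constructor <;> intro h <;> linarith

theorem fiber_le_orthFiber (x : M) : E.fiber x ≤ E.orthFiber x := fun u hu =>
  LinearMap.BilinForm.mem_orthogonal_iff.2 fun w hw => E.isotropic x w hw u hu

theorem charDist_le_charDist' (x : M) : E.charDist x ≤ E.charDist' x :=
  Submodule.map_mono (E.fiber_le_orthFiber x)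

/-- This is E'' = E, from the nondegeneracy of g. -/
theorem mem_fiber_of_forall_orthFiber {x : M} {u : BigTangent m M x}
    (h : ∀ w ∈ E.orthFiber x, w.2 u.1 + u.2 w.1 = 0) : u ∈ E.fiber x := by
  rw [← LinearMap.BilinForm.orthogonal_orthogonal (neutralMetric_nondegenerate x)
    (neutralMetric_isRefl x) (E.fiber x), LinearMap.BilinForm.mem_orthogonal_iff]
  intro w hw
  change (w.2 u.1 + u.2 w.1) / 2 = 0
  rw [h w hw, zero_div]

theorem finrank_fiber (x : M) : Module.finrank ℝ (E.fiber x) = k := by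
  obtain ⟨U, -, hx, s, -, hs⟩ := E.exists_local_frame x
  rw [← (hs x hx).2, finrank_span_eq_card (hs x hx).1, Fintype.card_fin]

variable {E} in
theorem IsAlmostDirac.orthFiber_eq (hE : E.IsAlmostDirac) (x : M) :
    E.orthFiber x = E.fiber x := by
  refine (Submodule.eq_of_le_of_finrank_le (E.fiber_le_orthFiber x) ?_).symm
  rw [orthFiber, LinearMap.BilinForm.finrank_orthogonal (neutralMetric_nondegenerate x),
    finrank_bigTangent, finrank_fiber]
  have : k = m := hE
  lia

/-- `𝓔'` is the annihilator of `E ∩ T^*M`. -/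
theorem mem_charDist'_of_annihilates {x : M} {v : TangentSpace (𝓡 m) x}
    (h : ∀ α : Cotangent m M x, ((0, α) : BigTangent m M x) ∈ E.fiber x → α v = 0) :
    v ∈ E.charDist' x := by
  obtain ⟨β, hβ⟩ := exists_dual_of_annihilates (V := Model m) (E.fiber x) v h
  exact E.mem_charDist'_iff.2 ⟨β, E.mem_orthFiber_iff.2 fun w hw => hβ w hw⟩

/-- The neutral metric on the model. -/
def modelMetric (w : BigModel m) : BigModel m →L[ℝ] ℝ :=
  w.2.comp (ContinuousLinearMap.fst ℝ (Model m) (Model m →L[ℝ] ℝ)) +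
    (ContinuousLinearMap.apply ℝ ℝ w.1).comp
      (ContinuousLinearMap.snd ℝ (Model m) (Model m →L[ℝ] ℝ))

theorem modelMetric_apply (w u : BigModel m) : modelMetric w u = w.2 u.1 + u.2 w.1 := rfl

theorem modelMetric_toBigModel {x y : M} (hy : y ∈ (chartAt (Model m) x).source)
    (w u : BigTangent m M y) :
    modelMetric (toBigModel x y w) (toBigModel x y u) = w.2 u.1 + u.2 w.1 := by
  rw [modelMetric_apply]
  change w.2 (fromModel x y (toModel x y u.1)) + u.2 (fromModel x y (toModel x y w.1)) = _
  rw [fromModel_toModel hy, fromModel_toModel hy]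

theorem eq_zero_of_modelMetric {w : BigModel m} (h : ∀ u, modelMetric w u = 0) : w = 0 := by
  refine Prod.ext (SeparatingDual.eq_zero_of_forall_dual_eq_zero (R := ℝ) fun η => ?_)
    (ContinuousLinearMap.ext fun v => ?_)
  · simpa [modelMetric_apply] using h (0, η)
  · simpa [modelMetric_apply] using h (v, 0)

/-- There are sections of `E'` through all its elements. -/
theorem exists_orth_section_through [T2Space M] {x : M} {u : BigTangent m M x}
    (hu : u ∈ E.orthFiber x) :
    ∃ σ : BigField m M, SmoothBigFieldOn σ Set.univ ∧ (∀ y, σ y ∈ E.orthFiber y) ∧ σ x = u := by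
  obtain ⟨S, hS, hSE⟩ := E.exists_chart_frame x
  have hs := mem_chart_source (Model m) x
  let e : Fin k → Fin k → ℝ := fun j => Pi.single j 1
  let Q : Model m → BigModel m →L[ℝ] (Fin k → ℝ) := fun p =>
    ContinuousLinearMap.pi fun j => modelMetric (S p (e j))
  have hQ : ∀ p w c, modelMetric (S p c) w = ∑ j, c j * Q p w j := by
    intro p w c
    have h1 : S p c = ∑ j, c j • S p (e j) := by
      conv_lhs => rw [pi_eq_sum_univ' c]
      simp [map_sum, e]
    rw [h1]
    simp [Q, modelMetric_apply, Finset.sum_add_distrib, mul_add, Prod.fst_sum, Prod.snd_sum]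
  have hQs : ∀ᶠ p in 𝓝 (extChartAt (𝓡 m) x x), ContDiffAt ℝ ∞ Q p := by
    filter_upwards [hS] with p hp
    refine contDiffAt_clm_of_apply fun w => contDiffAt_pi.2 fun j => ?_
    have h1 : ContDiffAt ℝ ∞ (fun p => S p (e j)) p := hp.clm_apply contDiffAt_const
    exact (h1.snd.clm_apply contDiffAt_const).add (contDiffAt_const.clm_apply h1.fst)
  -- A functional φ vanishing on the image of `Q` yields the combination of the frame with
  -- coefficients φ(e j), orthogonal to everything. It is 0 by nondegeneracy, and φ = 0 by
  -- independence of the frame.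
  have hQsurj : Function.Surjective (Q (extChartAt (𝓡 m) x x)) := by
    have h : Function.Surjective (Q (extChartAt (𝓡 m) x x)).toLinearMap := by
      rw [← LinearMap.dualMap_injective_iff, injective_iff_map_eq_zero]
      intro φ hφ
      have h1 : S (extChartAt (𝓡 m) x x) (fun j => φ (e j)) = 0 := by
        refine eq_zero_of_modelMetric fun w => ?_
        rw [hQ]
        have h2 : φ (Q (extChartAt (𝓡 m) x x) w) = 0 := LinearMap.congr_fun hφ w
        rw [pi_eq_sum_univ' (Q (extChartAt (𝓡 m) x x) w)] at h2
        simpa [map_sum, e, mul_comm] using h2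
      have h3 : (fun j => φ (e j)) = 0 :=
        hSE.self_of_nhds.1 (by rw [h1, map_zero])
      refine LinearMap.pi_ext' fun j => LinearMap.ext_ring ?_
      exact congrFun h3 j
    exact h
  obtain ⟨T, hT, hQT⟩ := exists_smooth_rightInverse hQs hQsurj
  have hmem : ∀ᶠ p in 𝓝 (extChartAt (𝓡 m) x x), ∀ w, Q p w = 0 ↔
      fromBigModel x ((extChartAt (𝓡 m) x).symm p) w ∈
        E.orthFiber ((extChartAt (𝓡 m) x).symm p) := by
    filter_upwards [hSE, eventually_mem_target x] with p hp hpt w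
    have hsrc := mem_chartSource_of_mem_target hpt
    rw [mem_orthFiber_iff]
    constructor
    · intro hw z hz
      rw [← fromBigModel_toBigModel hsrc z, hp.2] at hz
      obtain ⟨c, hc⟩ := hz
      rw [← modelMetric_toBigModel hsrc, toBigModel_fromBigModel hsrc, ← hc, hQ, hw]
      simp
    · intro hw
      funext j
      have h1 := hw _ ((hp.2 (S p (e j))).2 ⟨_, rfl⟩)
      rwa [← modelMetric_toBigModel hsrc, toBigModel_fromBigModel hsrc,
        toBigModel_fromBigModel hsrc] at h1
  let u₀ := toBigModel x x u
  -- In the chart E' is the kernel of `Q`; `1 - T Q` projects onto it and fixes `u₀` at the centre.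
  obtain ⟨σ, hσs, hσE, hσ⟩ := exists_global_extension E.orthFiber x
    (f := fun p => u₀ - T p (Q p u₀))
    (by
      filter_upwards [hQs, hT] with p h1 h2
      exact contDiffAt_const.sub (h2.clm_apply (h1.clm_apply contDiffAt_const)))
    (by
      filter_upwards [hmem, hQT] with p h1 h2
      rw [← h1, map_sub, h2, sub_self])
  refine ⟨σ, hσs, hσE, ?_⟩
  have h0 : Q (extChartAt (𝓡 m) x x) u₀ = 0 := by
    rw [hmem.self_of_nhds, extChartAt_to_inv, fromBigModel_toBigModel hs]
    exact hu
  have h1 := hσ.self_of_nhds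
  rw [chartBig_self, h0, map_zero, sub_zero] at h1
  rw [← fromBigModel_toBigModel hs (σ x), h1, fromBigModel_toBigModel hs]

end Orthogonal

end BigIsotropic

section Derivatives

variable {m : ℕ} {M : Type*} [TopologicalSpace M] [ChartedSpace (Model m) M]

theorem dFun_eq_zero_of_eventuallyEq {f : M → ℝ} {x : M} (h : ∀ᶠ y in 𝓝 x, f y = 0) :
    dFun (m := m) f x = 0 := by
  have h' : f =ᶠ[𝓝 x] fun _ => (0 : ℝ) := h
  rw [dFun, h'.mfderiv_eq]
  exact mfderiv_const

theorem dFun_two_mul {f : M → ℝ} {x : M} (hf : MDifferentiableAt (𝓡 m) 𝓘(ℝ, ℝ) f x)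
    (v : TangentSpace (𝓡 m) x) : dFun (fun y => 2 * f y) x v = 2 * dFun f x v :=
  congrArg (fun L => L v) (const_smul_mfderiv hf (2 : ℝ))

theorem hasDerivAlong_of_curve {X : VField m M} {f F : M → ℝ} {γ : ℝ → M} {x : M}
    (h0 : γ 0 = x) (hγ : IsMIntegralCurveAt (I := 𝓡 m) γ X 0)
    (hF : ContMDiff (𝓡 m) 𝓘(ℝ, ℝ) ∞ F) (hfF : ∀ᶠ t in 𝓝 (0 : ℝ), f (γ t) = F (γ t)) :
    HasDerivAlong X f x (dFun F x (X x)) := by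
  subst h0
  refine ⟨γ, rfl, hγ, ?_⟩
  have h : (fun t => f (γ t)) =ᶠ[𝓝 0] fun t => F (γ t) := hfF
  exact (hasDerivAt_comp_curve hγ.self_of_nhds hF).congr_of_eventuallyEq h

/-- The definition only asks for some integral curve; integral curves with the same initial point
agree near 0. -/
theorem HasDerivAlong.unique [IsManifold (𝓡 m) ∞ M] {X : VField m M} {f : M → ℝ} {x : M}
    {c c' : ℝ} (hX : SmoothVFieldOn X Set.univ) (h : HasDerivAlong X f x c)
    (h' : HasDerivAlong X f x c') : c = c' := by
  obtain ⟨γ, h0, hγ, hd⟩ := h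
  obtain ⟨γ', h0', hγ', hd'⟩ := h'
  have he : γ =ᶠ[𝓝 0] γ' := isMIntegralCurveAt_eventuallyEq_of_contMDiffAt_boundaryless
    ((hX.contMDiffAt' _).of_le (by simp)) hγ hγ' (h0.trans h0'.symm)
  refine hd.unique (hd'.congr_of_eventuallyEq ?_)
  filter_upwards [he] with t ht
  rw [ht]

end Derivatives

/-! ### Integrability and d_tr ϖ. -/

namespace BigIsotropic

variable {m k : ℕ} {M : Type*} [TopologicalSpace M] [ChartedSpace (Model m) M]
  [IsManifold (𝓡 m) ∞ M] {E : BigIsotropic m k M}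

theorem IsSection.isSmoothFieldIn {σ : BigField m M} (hσ : E.IsSection σ) :
    IsSmoothFieldIn (fun y => (σ y).1) E.charDist :=
  ⟨hσ.1.1, fun y => E.mem_charDist_iff.2 ⟨(σ y).2, hσ.2 y⟩⟩

theorem IsSection.sub {σ τ : BigField m M} (hσ : E.IsSection σ) (hτ : E.IsSection τ) :
    E.IsSection (fun y => σ y - τ y) :=
  ⟨⟨hσ.1.1.sub hτ.1.1, hσ.1.2.sub hτ.1.2⟩, fun y => (E.fiber y).sub_mem (hσ.2 y) (hτ.2 y)⟩

theorem isSmoothFieldIn_charDist' {X : VField m M} (hX : IsSmoothFieldIn X E.charDist) :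
    IsSmoothFieldIn X E.charDist' :=
  ⟨hX.1, fun y => E.charDist_le_charDist' y (hX.2 y)⟩

theorem IsSection.add_eq_zero {σ τ : BigField m M} (hσ : E.IsSection σ) (hτ : E.IsSection τ)
    (y : M) : (σ y).2 (τ y).1 + (τ y).2 (σ y).1 = 0 :=
  E.mem_orthFiber_iff.1 (E.fiber_le_orthFiber y (hτ.2 y)) _ (hσ.2 y)

theorem varpi_eq_apply {σ : BigField m M} (hσ : E.IsSection σ) {y : M}
    {Y : TangentSpace (𝓡 m) y} (hY : Y ∈ E.charDist' y) :
    E.varpi y (σ y).1 Y = (σ y).2 Y := by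
  obtain ⟨β, hβ⟩ := E.mem_charDist'_iff.1 hY
  exact (E.varpi_eq (hσ.2 y) hβ).2.1

/-- The evaluation of the Courant bracket of two sections of `E`. -/
theorem IsSection.courantBracket_snd_apply {σ τ : BigField m M} (hσ : E.IsSection σ)
    (hτ : E.IsSection τ) {Y : VField m M} (hY : SmoothVFieldOn Y Set.univ) (x : M) :
    (courantBracket σ τ x).2 (Y x) =
      dFun (fun y => (τ y).2 (Y y)) x (σ x).1 - dFun (fun y => (σ y).2 (Y y)) x (τ x).1
        + dFun (fun y => (σ y).2 (τ y).1) x (Y x)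
        - (τ x).2 (VectorField.mlieBracket (𝓡 m) (fun y => (σ y).1) Y x)
        + (σ x).2 (VectorField.mlieBracket (𝓡 m) (fun y => (τ y).1) Y x) := by
  -- Isotropy makes the pairing skew on sections of E; the factor 2 absorbs the 1/2 of the exact
  -- term.
  have h1 : (fun y => (σ y).2 (τ y).1 - (τ y).2 (σ y).1) = fun y => 2 * (σ y).2 (τ y).1 := by
    funext y
    linarith [hσ.add_eq_zero hτ y]
  rw [BigIso.courantBracket_snd_apply hσ.1 hτ.1 hY, h1,
    dFun_two_mul ((contMDiff_pairing hσ.1.2 hτ.1.1 x).mdifferentiableAt (by simp))]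
  ring

/-- `d_tr ϖ` in terms of lifts to sections of `E` which are only valid along the integral
curves. -/
theorem hasDtrVarpi_of_lifts {X₁ X₂ Y : VField m M} {x : M} {σ₁ σ₂ : BigField m M}
    (hσ₁ : E.IsSection σ₁) (hσ₂ : E.IsSection σ₂) {Y' : VField m M}
    (hY' : IsSmoothFieldIn Y' E.charDist')
    (hc : ∀ Z : VField m M, Z = X₁ ∨ Z = X₂ ∨ Z = Y → ∃ γ : ℝ → M, γ 0 = x ∧
      IsMIntegralCurveAt (I := 𝓡 m) γ Z 0 ∧ ∀ᶠ t in 𝓝 (0 : ℝ),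
        X₁ (γ t) = (σ₁ (γ t)).1 ∧ X₂ (γ t) = (σ₂ (γ t)).1 ∧ Y (γ t) = Y' (γ t))
    (h1 : VectorField.mlieBracket (𝓡 m) X₁ Y x =
      VectorField.mlieBracket (𝓡 m) (fun y => (σ₁ y).1) Y' x)
    (h2 : VectorField.mlieBracket (𝓡 m) X₂ Y x =
      VectorField.mlieBracket (𝓡 m) (fun y => (σ₂ y).1) Y' x)
    (hb12 : VectorField.mlieBracket (𝓡 m) X₁ X₂ x ∈ E.charDist x)
    (hb1 : VectorField.mlieBracket (𝓡 m) X₁ Y x ∈ E.charDist' x)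
    (hb2 : VectorField.mlieBracket (𝓡 m) X₂ Y x ∈ E.charDist' x) :
    E.HasDtrVarpi X₁ X₂ Y x ((courantBracket σ₁ σ₂ x).2 (Y x) -
      E.varpi x (VectorField.mlieBracket (𝓡 m) X₁ X₂ x) (Y x)) := by
  obtain ⟨γ₁, h01, hγ₁, he₁⟩ := hc X₁ (Or.inl rfl)
  obtain ⟨γ₂, h02, hγ₂, he₂⟩ := hc X₂ (Or.inr (Or.inl rfl))
  obtain ⟨γ₃, h03, hγ₃, he₃⟩ := hc Y (Or.inr (Or.inr rfl))
  have hx := he₁.self_of_nhds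
  rw [h01] at hx
  refine ⟨_, _, _,
    hasDerivAlong_of_curve h01 hγ₁ (contMDiff_pairing hσ₂.1.2 hY'.1) (he₁.mono fun t ht => ?_),
    hasDerivAlong_of_curve h02 hγ₂ (contMDiff_pairing hσ₁.1.2 hY'.1) (he₂.mono fun t ht => ?_),
    hasDerivAlong_of_curve h03 hγ₃ (contMDiff_pairing hσ₁.1.2 hσ₂.1.1) (he₃.mono fun t ht => ?_),
    hb12, hb1, hb2, ?_⟩
  · rw [ht.2.1, ht.2.2, varpi_eq_apply hσ₂ (hY'.2 _)]
  · rw [ht.1, ht.2.2, varpi_eq_apply hσ₁ (hY'.2 _)]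
  · rw [ht.1, ht.2.1, varpi_eq_apply hσ₁ ((isSmoothFieldIn_charDist' hσ₂.isSmoothFieldIn).2 _)]
  · rw [hx.1, hx.2.1, hx.2.2, hσ₁.courantBracket_snd_apply hσ₂ hY'.1, varpi_eq_apply hσ₁ hb2,
      varpi_eq_apply hσ₂ hb1, h1, h2]
    ring

theorem HasDtrVarpi.unique {X₁ X₂ Y : VField m M} {x : M} {c c' : ℝ}
    (hX₁ : SmoothVFieldOn X₁ Set.univ) (hX₂ : SmoothVFieldOn X₂ Set.univ)
    (hY : SmoothVFieldOn Y Set.univ) (h : E.HasDtrVarpi X₁ X₂ Y x c)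
    (h' : E.HasDtrVarpi X₁ X₂ Y x c') : c = c' := by
  obtain ⟨a₁, a₂, a₃, h₁, h₂, h₃, -, -, -, rfl⟩ := h
  obtain ⟨b₁, b₂, b₃, h₁', h₂', h₃', -, -, -, rfl⟩ := h'
  rw [h₁.unique hX₁ h₁', h₂.unique hX₂ h₂', h₃.unique hY h₃']

/-- The converse part: involutivity, invariance and the vanishing of `d_tr ϖ` imply that `E` is
integrable. -/
theorem integrable_of_hasDtrVarpi [T2Space M] (hI : E.IsInvolutive) (hI' : E.IsInvariant)
    (h : ∀ X₁ X₂ Y : VField m M, IsSmoothFieldIn X₁ E.charDist → IsSmoothFieldIn X₂ E.charDist →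
      IsSmoothFieldIn Y E.charDist' → ∀ (x : M) (c : ℝ), E.HasDtrVarpi X₁ X₂ Y x c → c = 0) :
    E.Integrable := by
  intro s t hs ht
  refine ⟨hs.1.courantBracket ht.1, fun x => E.mem_fiber_of_forall_orthFiber fun w hw => ?_⟩
  obtain ⟨ρ, hρs, hρE, hρ⟩ := E.exists_orth_section_through hw
  have hX₁ := hs.isSmoothFieldIn
  have hX₂ := ht.isSmoothFieldIn
  have hY : IsSmoothFieldIn (fun y => (ρ y).1) E.charDist' :=
    ⟨hρs.1, fun y => E.mem_charDist'_iff.2 ⟨(ρ y).2, hρE y⟩⟩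
  have hb12 := hI _ _ hX₁ hX₂ x
  have hdtr := h _ _ _ hX₁ hX₂ hY x _ (hasDtrVarpi_of_lifts hs ht hY (fun Z hZ => by
      have hZs : SmoothVFieldOn Z Set.univ := by
        rcases hZ with rfl | rfl | rfl
        exacts [hX₁.1, hX₂.1, hY.1]
      obtain ⟨γ, h0, hγ⟩ := exists_integralCurve hZs x
      exact ⟨γ, h0, hγ, Filter.Eventually.of_forall fun t => ⟨rfl, rfl, rfl⟩⟩)
    rfl rfl hb12 (hI' _ _ hX₁ hY x) (hI' _ _ hX₂ hY x))
  -- By involutivity ϖ([X₁, X₂], Y) = -w.2([X₁, X₂]), so the vanishing of d_tr ϖ is the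
  -- orthogonality of the Courant bracket to `w`.
  obtain ⟨ζ, hζ⟩ := E.mem_charDist_iff.1 hb12
  have h1 := (E.varpi_eq hζ (hρE x)).2.2
  rw [hρ] at hdtr h1
  have h2 : w.2 (courantBracket s t x).1 =
    w.2 (VectorField.mlieBracket (𝓡 m) (fun y => (s y).1) (fun y => (t y).1) x) := rfl
  rw [h2]
  linarith

/-- Integral curves of the fields of `𝓔` along which the dimension of `𝓔` does not increase. -/
theorem exists_curve [T2Space M] (hE : E.Integrable) {X : VField m M}
    (hX : IsSmoothFieldIn X E.charDist) (x : M) :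
    ∃ γ : ℝ → M, γ 0 = x ∧ IsMIntegralCurveAt (I := 𝓡 m) γ X 0 ∧
      ∀ᶠ t in 𝓝 (0 : ℝ), Module.finrank ℝ (E.charDist (γ t)) ≤
        Module.finrank ℝ (E.charDist x) := by
  obtain ⟨σ, hσ, hσX, -⟩ := E.exists_lift hX x
  obtain ⟨γ, h0, hγ⟩ := exists_integralCurve hσ.1.1 x
  have hr := E.eventually_finrank_le_of_curve hE hσ h0 hγ
  have hγx : Filter.Tendsto γ (𝓝 0) (𝓝 x) := by
    have := hγ.continuousAt
    rwa [ContinuousAt, h0] at this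
  refine ⟨γ, h0, ?_, hr⟩
  -- Since dim 𝓔 does not increase along the curve of pr σ, the lift is exact there, and the curve
  -- is also an integral curve of X.
  filter_upwards [hγ, hr, hγx.eventually hσX] with t h1 h2 h3
  rwa [← h3 h2]

theorem mlieBracket_congr_of_lift [T2Space M] (hE : E.Integrable) {X Y Y' : VField m M}
    (hX : IsSmoothFieldIn X E.charDist) (hY : SmoothVFieldOn Y Set.univ)
    (hY' : SmoothVFieldOn Y' Set.univ) {x : M}
    (h : ∀ᶠ y in 𝓝 x, Module.finrank ℝ (E.charDist y) ≤ Module.finrank ℝ (E.charDist x) →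
      Y' y = Y y) :
    VectorField.mlieBracket (𝓡 m) X Y x = VectorField.mlieBracket (𝓡 m) X Y' x := by
  obtain ⟨γ, h0, hγ, hr⟩ := exists_curve hE hX x
  have hγx : Filter.Tendsto γ (𝓝 0) (𝓝 x) := by
    have := hγ.continuousAt
    rwa [ContinuousAt, h0] at this
  have h1 : VectorField.mlieBracket (𝓡 m) X (Y - Y') x = 0 := by
    refine mlieBracket_eq_zero_of_curve hX.1 (hY.sub hY') h0 hγ ?_
    filter_upwards [hr, hγx.eventually h] with t h2 h3
    rw [Pi.sub_apply, h3 h2, sub_self]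
  have h2 := VectorField.mlieBracket_add_right (I := 𝓡 m) (V := X) (W := Y') (W₁ := Y - Y')
    (hY'.mdifferentiableAt x) ((hY.sub hY').mdifferentiableAt x)
  rw [h1, add_zero, add_sub_cancel] at h2
  exact h2

/-- One argument is replaced at a time, always the one that is not followed along its integral
curve; antisymmetry exchanges the roles. -/
theorem mlieBracket_congr_of_lifts [T2Space M] (hE : E.Integrable) {X₁ X₂ : VField m M} {x : M}
    (hX₁ : IsSmoothFieldIn X₁ E.charDist) (hX₂ : IsSmoothFieldIn X₂ E.charDist)
    {σ₁ σ₂ : BigField m M} (hσ₁ : E.IsSection σ₁) (hσ₂ : E.IsSection σ₂)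
    (h₁ : ∀ᶠ y in 𝓝 x, Module.finrank ℝ (E.charDist y) ≤ Module.finrank ℝ (E.charDist x) →
      (σ₁ y).1 = X₁ y)
    (h₂ : ∀ᶠ y in 𝓝 x, Module.finrank ℝ (E.charDist y) ≤ Module.finrank ℝ (E.charDist x) →
      (σ₂ y).1 = X₂ y) :
    VectorField.mlieBracket (𝓡 m) X₁ X₂ x =
      VectorField.mlieBracket (𝓡 m) (fun y => (σ₁ y).1) (fun y => (σ₂ y).1) x := by
  rw [mlieBracket_congr_of_lift hE hX₁ hX₂.1 hσ₂.1.1 h₂, VectorField.mlieBracket_swap_apply,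
    mlieBracket_congr_of_lift hE hσ₂.isSmoothFieldIn hX₁.1 hσ₁.1.1 h₁,
    VectorField.mlieBracket_swap_apply, neg_neg]

theorem Integrable.mlieBracket_mem (hE : E.Integrable) {σ τ : BigField m M}
    (hσ : E.IsSection σ) (hτ : E.IsSection τ) (x : M) :
    VectorField.mlieBracket (𝓡 m) (fun y => (σ y).1) (fun y => (τ y).1) x ∈ E.charDist x :=
  E.mem_charDist_iff.2 ⟨(courantBracket σ τ x).2, (hE σ τ hσ hτ).2 x⟩

theorem Integrable.isInvolutive [T2Space M] (hE : E.Integrable) : E.IsInvolutive := by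
  intro X₁ X₂ hX₁ hX₂ x
  obtain ⟨σ₁, hσ₁, h₁, -⟩ := E.exists_lift hX₁ x
  obtain ⟨σ₂, hσ₂, h₂, -⟩ := E.exists_lift hX₂ x
  rw [mlieBracket_congr_of_lifts hE hX₁ hX₂ hσ₁ hσ₂ h₁ h₂]
  exact hE.mlieBracket_mem hσ₁ hσ₂ x

theorem Integrable.courantBracket_snd_eq_varpi (hE : E.Integrable) {σ τ : BigField m M}
    (hσ : E.IsSection σ) (hτ : E.IsSection τ) {x : M} {Y : TangentSpace (𝓡 m) x}
    (hY : Y ∈ E.charDist' x) :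
    (courantBracket σ τ x).2 Y =
      E.varpi x (VectorField.mlieBracket (𝓡 m) (fun y => (σ y).1) (fun y => (τ y).1) x) Y :=
  (varpi_eq_apply (hE σ τ hσ hτ) hY).symm

/-- For integrable `E`, `d_tr ϖ` vanishes on the fields of `𝓔`. -/
theorem Integrable.hasDtrVarpi [T2Space M] (hE : E.Integrable) {X₁ X₂ X₃ : VField m M}
    (hX₁ : IsSmoothFieldIn X₁ E.charDist) (hX₂ : IsSmoothFieldIn X₂ E.charDist)
    (hX₃ : IsSmoothFieldIn X₃ E.charDist) (x : M) : E.HasDtrVarpi X₁ X₂ X₃ x 0 := by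
  obtain ⟨σ₁, hσ₁, h₁, -⟩ := E.exists_lift hX₁ x
  obtain ⟨σ₂, hσ₂, h₂, -⟩ := E.exists_lift hX₂ x
  obtain ⟨σ₃, hσ₃, h₃, -⟩ := E.exists_lift hX₃ x
  have h12 := mlieBracket_congr_of_lifts hE hX₁ hX₂ hσ₁ hσ₂ h₁ h₂
  have key := hasDtrVarpi_of_lifts hσ₁ hσ₂ (isSmoothFieldIn_charDist' hσ₃.isSmoothFieldIn)
    (X₁ := X₁) (X₂ := X₂) (Y := X₃) (x := x) (fun Z hZ => by
      have hZs : IsSmoothFieldIn Z E.charDist := by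
        rcases hZ with rfl | rfl | rfl
        exacts [hX₁, hX₂, hX₃]
      obtain ⟨γ, h0, hγ, hr⟩ := exists_curve hE hZs x
      have hγx : Filter.Tendsto γ (𝓝 0) (𝓝 x) := by
        have := hγ.continuousAt
        rwa [ContinuousAt, h0] at this
      refine ⟨γ, h0, hγ, ?_⟩
      filter_upwards [hr, hγx.eventually h₁, hγx.eventually h₂, hγx.eventually h₃]
        with t ht h4 h5 h6 using ⟨(h4 ht).symm, (h5 ht).symm, (h6 ht).symm⟩)
    (mlieBracket_congr_of_lifts hE hX₁ hX₃ hσ₁ hσ₃ h₁ h₃)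
    (mlieBracket_congr_of_lifts hE hX₂ hX₃ hσ₂ hσ₃ h₂ h₃) (hE.isInvolutive _ _ hX₁ hX₂ x)
    (E.charDist_le_charDist' x (hE.isInvolutive _ _ hX₁ hX₃ x))
    (E.charDist_le_charDist' x (hE.isInvolutive _ _ hX₂ hX₃ x))
  rwa [hE.courantBracket_snd_eq_varpi hσ₁ hσ₂ (E.charDist_le_charDist' x (hX₃.2 x)), h12,
    sub_self] at key

/-- For regular `E`, the fields of `𝓔` lift locally to sections of `E`. -/
theorem IsRegular.exists_lift [T2Space M] (hR : E.IsRegular) {X : VField m M}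
    (hX : IsSmoothFieldIn X E.charDist) (x : M) :
    ∃ σ : BigField m M, E.IsSection σ ∧ (fun y => (σ y).1) =ᶠ[𝓝 x] X ∧ (X x = 0 → σ x = 0) := by
  obtain ⟨r, hr⟩ := hR
  obtain ⟨σ, hσ, h, h0⟩ := E.exists_lift hX x
  exact ⟨σ, hσ, h.mono fun y hy => hy (by rw [hr, hr]), h0⟩

theorem Integrable.isInvariant_of_isRegular [T2Space M] (hE : E.Integrable) (hR : E.IsRegular) :
    E.IsInvariant := by
  intro X Y hX hY x
  obtain ⟨σ, hσ, hσX, -⟩ := hR.exists_lift hX x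
  refine E.mem_charDist'_of_annihilates fun α hα => ?_
  obtain ⟨τ, hτ, hτx⟩ := E.exists_section_through hα
  obtain ⟨τ', hτ', hττ', h0⟩ := hR.exists_lift hτ.isSmoothFieldIn x
  -- τ' lifts the vector part of τ near `x` and is 0 at `x`, where that part vanishes. So τ - τ' is
  -- a section of E through (0, α) whose vector part is 0 near `x`.
  have hρ := hτ.sub hτ'
  have hρx : τ x - τ' x = (0, α) := by
    rw [hτx, h0 (by rw [hτx]), sub_zero]
  have hρ1 : ∀ᶠ y in 𝓝 x, (τ y - τ' y).1 = 0 := by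
    filter_upwards [hττ'] with y hy
    rw [Prod.fst_sub, hy, sub_self]
  have hρ1' : (fun y => (τ y - τ' y).1) =ᶠ[𝓝 x] (0 : VField m M) := hρ1
  have hb : ∀ Z : VField m M, VectorField.mlieBracket (𝓡 m) (fun y => (τ y - τ' y).1) Z x = 0 := by
    intro Z
    rw [hρ1'.mlieBracket_vectorField_eq (Filter.EventuallyEq.refl _ Z),
      VectorField.mlieBracket_zero_left]
    rfl
  have hform := hσ.courantBracket_snd_apply hρ hY.1 x
  have hmem := (hE σ _ hσ hρ).2 x
  have hfst : (courantBracket σ (fun y => τ y - τ' y) x).1 = 0 := by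
    change VectorField.mlieBracket (𝓡 m) _ _ x = 0
    rw [VectorField.mlieBracket_swap_apply, hb, neg_zero]
  have hpair : ∀ y, ∀ u : BigTangent m M y, u ∈ E.fiber y → u.1 = 0 → u.2 (Y y) = 0 := by
    intro y u hu hu1
    obtain ⟨β, hβ⟩ := E.mem_charDist'_iff.1 (hY.2 y)
    have := E.mem_orthFiber_iff.1 hβ u hu
    rw [hu1] at this
    simpa using this
  have hd1 : dFun (m := m) (fun y => (τ y - τ' y).2 (Y y)) x = 0 :=
    dFun_eq_zero_of_eventuallyEq (hρ1.mono fun y hy => hpair y _ (hρ.2 y) hy)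
  have hd2 : dFun (m := m) (fun y => (σ y).2 (τ y - τ' y).1) x = 0 :=
    dFun_eq_zero_of_eventuallyEq (hρ1.mono fun y hy => by rw [hy, map_zero])
  -- The bracket of σ and τ - τ' lies in E ∩ T*M at `x`, so it vanishes on Y; the only term left in
  -- its expansion is -α([X, Y]).
  rw [hpair x _ hmem hfst, hb, hd1, hd2, hρx, hσX.mlieBracket_vectorField_eq (Filter.EventuallyEq.refl _ Y)] at hform
  simpa using hform

/-- Only X₁ and X₂ have to be lifted, and regularity makes the lifts exact near `x`, so the integral
curves of Y, which may leave 𝓔, cause no trouble. -/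
theorem Integrable.hasDtrVarpi_of_isRegular [T2Space M] (hE : E.Integrable) (hR : E.IsRegular)
    {X₁ X₂ Y : VField m M} (hX₁ : IsSmoothFieldIn X₁ E.charDist)
    (hX₂ : IsSmoothFieldIn X₂ E.charDist) (hY : IsSmoothFieldIn Y E.charDist') (x : M) :
    E.HasDtrVarpi X₁ X₂ Y x 0 := by
  obtain ⟨σ₁, hσ₁, h₁, -⟩ := hR.exists_lift hX₁ x
  obtain ⟨σ₂, hσ₂, h₂, -⟩ := hR.exists_lift hX₂ x
  have hI := hE.isInvariant_of_isRegular hR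
  have h12 := h₁.symm.mlieBracket_vectorField_eq (I := 𝓡 m) h₂.symm
  have key := hasDtrVarpi_of_lifts hσ₁ hσ₂ hY (X₁ := X₁) (X₂ := X₂) (Y := Y) (x := x)
    (fun Z hZ => by
      have hZs : SmoothVFieldOn Z Set.univ := by
        rcases hZ with rfl | rfl | rfl
        exacts [hX₁.1, hX₂.1, hY.1]
      obtain ⟨γ, h0, hγ⟩ := exists_integralCurve hZs x
      have hγx : Filter.Tendsto γ (𝓝 0) (𝓝 x) := by
        have := hγ.continuousAt
        rwa [ContinuousAt, h0] at this
      refine ⟨γ, h0, hγ, ?_⟩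
      filter_upwards [hγx.eventually h₁, hγx.eventually h₂] with t h4 h5
        using ⟨h4.symm, h5.symm, rfl⟩)
    (h₁.symm.mlieBracket_vectorField_eq (Filter.EventuallyEq.refl _ Y))
    (h₂.symm.mlieBracket_vectorField_eq (Filter.EventuallyEq.refl _ Y))
    (hE.isInvolutive _ _ hX₁ hX₂ x) (hI _ _ hX₁ hY x) (hI _ _ hX₂ hY x)
  rwa [hE.courantBracket_snd_eq_varpi hσ₁ hσ₂ (hY.2 x), h12, sub_self] at key

theorem IsAlmostDirac.charDist'_eq (hD : E.IsAlmostDirac) : E.charDist' = E.charDist := by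
  funext x
  rw [charDist', charDist, hD.orthFiber_eq]

end BigIsotropic

end BigIso

end

theorem proposition2p3 {m k : ℕ} {M : Type*} [TopologicalSpace M] [T2Space M]
    [ChartedSpace (BigIso.Model m) M] [IsManifold (𝓡 m) ∞ M]
    (E : BigIso.BigIsotropic m k M) :
    -- for integrable `E`, `d_tr ϖ` is defined and vanishes on vector fields of `𝓔`
    (E.Integrable → ∀ X₁ X₂ X₃ : BigIso.VField m M,
      BigIso.IsSmoothFieldIn X₁ E.charDist → BigIso.IsSmoothFieldIn X₂ E.charDist →
      BigIso.IsSmoothFieldIn X₃ E.charDist →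
      ∀ x, E.HasDtrVarpi X₁ X₂ X₃ x 0) ∧
    (E.IsAlmostDirac ∨ E.IsRegular →
      -- the characterization of integrability
      (E.Integrable ↔
        E.IsInvolutive ∧ E.IsInvariant ∧
          ∀ X₁ X₂ Y : BigIso.VField m M,
            BigIso.IsSmoothFieldIn X₁ E.charDist → BigIso.IsSmoothFieldIn X₂ E.charDist →
            BigIso.IsSmoothFieldIn Y E.charDist' →
            ∀ x, E.HasDtrVarpi X₁ X₂ Y x 0) ∧
      -- for the sufficiency, it is enough that `d_tr ϖ` vanishes wherever it makes sense
      (E.IsInvolutive → E.IsInvariant →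
        (∀ X₁ X₂ Y : BigIso.VField m M,
          BigIso.IsSmoothFieldIn X₁ E.charDist → BigIso.IsSmoothFieldIn X₂ E.charDist →
          BigIso.IsSmoothFieldIn Y E.charDist' →
          ∀ (x : M) (c : ℝ), E.HasDtrVarpi X₁ X₂ Y x c → c = 0) →
        E.Integrable)) := by
  refine ⟨fun hE X₁ X₂ X₃ h₁ h₂ h₃ x => hE.hasDtrVarpi h₁ h₂ h₃ x, fun hDR => ⟨⟨fun hE => ?_, ?_⟩,
    fun hI hI' h => BigIso.BigIsotropic.integrable_of_hasDtrVarpi hI hI' h⟩⟩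
  · refine ⟨hE.isInvolutive, ?_⟩
    -- In the almost Dirac case 𝓔' = 𝓔: invariance is involutivity, and (c) is the first assertion.
    rcases hDR with hD | hR
    · refine ⟨fun X Y hX hY x => ?_, fun X₁ X₂ Y h₁ h₂ hY x => ?_⟩
      · rw [hD.charDist'_eq] at hY ⊢
        exact hE.isInvolutive X Y hX hY x
      · rw [hD.charDist'_eq] at hY
        exact hE.hasDtrVarpi h₁ h₂ hY x
    · exact ⟨hE.isInvariant_of_isRegular hR,
        fun X₁ X₂ Y h₁ h₂ hY x => hE.hasDtrVarpi_of_isRegular hR h₁ h₂ hY x⟩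
  · rintro ⟨hI, hI', h⟩
    exact BigIso.BigIsotropic.integrable_of_hasDtrVarpi hI hI' fun X₁ X₂ Y h₁ h₂ hY x c hc =>
      hc.unique h₁.1 h₂.1 hY.1 (h X₁ X₂ Y h₁ h₂ hY x)
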